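/- Let $\mathcal R\subset\mathbb C^n$ be a bounded Reinhardt domain (a bounded non-empty connected open set invariant under $(z_1,\dots,z_n)\mapsto(e^{i\theta_1}z_1,\dots,e^{i\theta_n}z_n)$ for all $\theta\in\mathbb R^n$), let $dV$ be Lebesgue measure, $A^p(\mathcal R)=\mathcal O(\mathcal R)\cap L^p(\mathcal R)$, and for $\alpha\in\mathbb Z^n$ let $e_\alpha(z)=z_1^{\alpha_1}\cdots z_n^{\alpha_n}$ and $\mathcal S(\mathcal R,L^p)=\{\alpha\in\mathbb Z^n: e_\alpha\in A^p(\mathcal R)\}$. Let $B(z,w)$ be the Bergman kernel of $\mathcal R$, and put $\boldsymbol Bf(z)=\int_{\mathcal R}B(z,w)f(w)\,dV(w)$ whenever this integral converges, and $|\boldsymbol B|f(z)=\int_{\mathcal R}|B(z,w)|f(w)\,dV(w)$. Let $1<p<2$ and suppose that $|\boldsymbol B|$ is bounded on $L^p(\mathcal R)$: for every $f\in L^p(\mathcal R)$ the integral $|\boldsymbol B|f(z)$ converges absolutely for almost every $z\in\mathcal R$, and $\||\boldsymbol B|f\|_p\le C\|f\|_p$ with a constant $C$ independent of $f$. Then: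 (i) If $\gamma\in\mathcal S(\mathcal R,L^p)\setminus\mathcal S(\mathcal R,L^2)$, then $e_\gamma\in\ker\boldsymbol B$; that is, for every $z\in\mathcal R$ the integral $\boldsymbol Be_\gamma(z)$ converges absolutely and equals $0$. (ii) Let $f\in A^p(\mathcal R)$. Then $f$ has a unique Laurent expansion $f=\sum_{\alpha\in\mathbb Z^n}a_\alpha(f)e_\alpha$ converging uniformly on compact subsets of $\mathcal R$, and $a_\alpha(f)=0$ for $\alpha\notin\mathcal S(\mathcal R,L^p)$. The integral $\boldsymbol Bf(z)$ converges absolutely for every $z\in\mathcal R$, $\boldsymbol Bf\in L^p(\mathcal R)$, and $$\boldsymbol Bf=\sum_{\alpha\in\mathcal S(\mathcal R,L^2)}a_\alpha(f)e_\alpha,$$ where the square partial sums converge in $L^p(\mathcal R)$: $$\Big\|\sum_{\alpha\in\mathcal S(\mathcal R,L^2),\ \max_j|\alpha_j|\le N}a_\alpha(f)e_\alpha-\boldsymbol Bf\Big\|_{L^p(\mathcal R)}\to0\quad\text{as }N\to\infty.$$ -/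

import Mathlib

open MeasureTheory Filter Topology
open scoped ENNReal NNReal

noncomputable section

/-- `f` (a function on `ℂⁿ`, of which only the restriction to `Ω` matters) belongs to the Bergman
space `A^p(Ω) = 𝒪(Ω) ∩ L^p(Ω)`. The measure is Lebesgue measure on `ℂⁿ = ℝ²ⁿ`. -/
def MemBergman {n : ℕ} (Ω : Set (Fin n → ℂ)) (p : ℝ≥0∞) (f : (Fin n → ℂ) → ℂ) : Prop :=
  DifferentiableOn ℂ f Ω ∧ MemLp f p (volume.restrict Ω)

/-- `K` is a Bergman kernel of `Ω`: for `z ∈ Ω` the function `w ↦ conj (K z w)` lies in `A²(Ω)`,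
and `f z = ∫_Ω K z w f(w) dV(w)` for all `f ∈ A²(Ω)`. -/
def IsBergmanKernel {n : ℕ} (Ω : Set (Fin n → ℂ)) (K : (Fin n → ℂ) → (Fin n → ℂ) → ℂ) : Prop :=
  ∀ z ∈ Ω, MemBergman Ω 2 (fun w => (starRingEnd ℂ) (K z w)) ∧
    ∀ f, MemBergman Ω 2 f → f z = ∫ w in Ω, K z w * f w

/-! ### Existence of the Bergman kernel -/

theorem bergman_circle_bound {g : ℂ → ℂ} (hg : DiffContOnCl ℂ g (Metric.ball 0 1)) :
    ‖g 0‖ₑ * ENNReal.ofReal (2 * Real.pi) ≤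
      ∫⁻ θ in Set.Ioc 0 (2 * Real.pi), ‖g (circleMap 0 1 θ)‖ₑ := by
  have h : Real.circleAverage g 0 1 = g 0 := DiffContOnCl.circleAverage (by simpa using hg)
  have hp : (0 : ℝ) < 2 * Real.pi := by positivity
  have h2 : (2 * Real.pi) • g 0 = ∫ θ in Set.Ioc 0 (2 * Real.pi), g (circleMap 0 1 θ) := by
    rw [← h, Real.circleAverage, intervalIntegral.integral_of_le hp.le, smul_smul,
      mul_inv_cancel₀ hp.ne', one_smul]
  calc ‖g 0‖ₑ * ENNReal.ofReal (2 * Real.pi) = ‖(2 * Real.pi) • g 0‖ₑ := by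
        rw [enorm_smul, mul_comm, Real.enorm_of_nonneg hp.le]
    _ ≤ _ := by rw [h2]; exact enorm_integral_le_lintegral_enorm _

theorem bergman_rotate {n : ℕ} (c : ℂ) (hc : ‖c‖ = 1) :
    MeasurePreserving (fun w : Fin n → ℂ => c • w) volume volume := by
  have h1 : MeasurePreserving (fun w : ℂ => c • w) volume volume := by
    let e : ℂ ≃ₗᵢ[ℝ] ℂ := rotation ⟨c, by simpa [Submonoid.unitSphere] using hc⟩
    exact e.measurePreserving
  exact volume_preserving_pi (fun _ : Fin n => h1)

theorem bergman_eval_sq {n : ℕ} {Ω : Set (Fin n → ℂ)} {f : (Fin n → ℂ) → ℂ}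
    (hf : DifferentiableOn ℂ f Ω) {z : Fin n → ℂ} {r : ℝ}
    (hz : Metric.closedBall z r ⊆ Ω) :
    ‖f z‖ₑ ^ 2 * volume (Metric.closedBall (0 : Fin n → ℂ) r) ≤
      ∫⁻ w in Ω, ‖f w‖ₑ ^ 2 := by
  have hp : (0 : ℝ) < 2 * Real.pi := by positivity
  set B := Metric.closedBall (0 : Fin n → ℂ) r with hB
  have hmem : ∀ w ∈ B, ∀ c : ℂ, ‖c‖ ≤ 1 → z + c • w ∈ Ω := by
    intro w hw c hc
    apply hz
    rw [hB, mem_closedBall_zero_iff] at hw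
    rw [mem_closedBall_iff_norm, add_sub_cancel_left, norm_smul]
    calc ‖c‖ * ‖w‖ ≤ 1 * ‖w‖ := by gcongr
      _ ≤ r := by rwa [one_mul]
  have hpt : ∀ w ∈ B, ‖f z‖ₑ ^ 2 * ENNReal.ofReal (2 * Real.pi) ≤
      ∫⁻ θ in Set.Ioc 0 (2 * Real.pi), ‖f (z + circleMap 0 1 θ • w)‖ₑ ^ 2 := by
    intro w hw
    have hd : DifferentiableOn ℂ (fun c : ℂ => f (z + c • w) ^ 2) (Metric.closedBall 0 1) := by
      refine DifferentiableOn.pow (hf.comp (by fun_prop) ?_) 2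
      intro c hc
      exact hmem w hw c (by simpa using hc)
    have := bergman_circle_bound (hd.diffContOnCl_ball subset_rfl)
    simpa [enorm_pow] using this
  have hcont : ContinuousOn (fun q : (Fin n → ℂ) × ℝ => ‖f (z + circleMap 0 1 q.2 • q.1)‖ₑ ^ 2)
      (B ×ˢ Set.Ioc 0 (2 * Real.pi)) := by
    have h1 : ContinuousOn (fun q : (Fin n → ℂ) × ℝ => f (z + circleMap 0 1 q.2 • q.1))
        (B ×ˢ Set.Ioc 0 (2 * Real.pi)) := by
      refine hf.continuousOn.comp ?_ ?_
      · have : Continuous (fun q : (Fin n → ℂ) × ℝ => circleMap 0 1 q.2) :=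
          (continuous_circleMap 0 1).comp continuous_snd
        fun_prop
      · rintro ⟨w, θ⟩ ⟨hw, -⟩
        exact hmem w hw _ (by simp)
    exact (ENNReal.continuous_pow 2).comp_continuousOn h1.enorm
  have hrot : ∀ θ : ℝ, ∫⁻ w in B, ‖f (z + circleMap 0 1 θ • w)‖ₑ ^ 2 ≤
      ∫⁻ w in Ω, ‖f w‖ₑ ^ 2 := by
    intro θ
    have hc : ‖circleMap 0 1 θ‖ = 1 := by simp
    have hmp : MeasurePreserving (fun w : Fin n → ℂ => z + circleMap 0 1 θ • w) volume volume :=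
      (measurePreserving_add_left volume z).comp (bergman_rotate _ hc)
    have hemb : MeasurableEmbedding (fun w : Fin n → ℂ => z + circleMap 0 1 θ • w) := by
      have hne : circleMap 0 1 θ ≠ 0 := by intro h; simp [h] at hc
      exact ((Homeomorph.smulOfNeZero _ hne).trans
        (Homeomorph.addLeft z)).measurableEmbedding
    calc ∫⁻ w in B, ‖f (z + circleMap 0 1 θ • w)‖ₑ ^ 2
        ≤ ∫⁻ w in (fun w : Fin n → ℂ => z + circleMap 0 1 θ • w) ⁻¹' Ω,
            ‖f (z + circleMap 0 1 θ • w)‖ₑ ^ 2 :=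
          lintegral_mono_set fun w hw => hmem w hw _ hc.le
      _ = _ := hmp.setLIntegral_comp_preimage_emb hemb (fun w => ‖f w‖ₑ ^ 2) Ω
  have hI : ‖f z‖ₑ ^ 2 * ENNReal.ofReal (2 * Real.pi) * volume B ≤
      (∫⁻ w in Ω, ‖f w‖ₑ ^ 2) * ENNReal.ofReal (2 * Real.pi) := by
    calc ‖f z‖ₑ ^ 2 * ENNReal.ofReal (2 * Real.pi) * volume B
        = ∫⁻ _ in B, ‖f z‖ₑ ^ 2 * ENNReal.ofReal (2 * Real.pi) := by simp
      _ ≤ ∫⁻ w in B, ∫⁻ θ in Set.Ioc 0 (2 * Real.pi), ‖f (z + circleMap 0 1 θ • w)‖ₑ ^ 2 :=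
          setLIntegral_mono' Metric.isClosed_closedBall.measurableSet hpt
      _ = ∫⁻ θ in Set.Ioc 0 (2 * Real.pi), ∫⁻ w in B, ‖f (z + circleMap 0 1 θ • w)‖ₑ ^ 2 := by
          refine lintegral_lintegral_swap ?_
          rw [Measure.prod_restrict]
          exact hcont.aemeasurable
            (Metric.isClosed_closedBall.measurableSet.prod measurableSet_Ioc)
      _ ≤ ∫⁻ _ in Set.Ioc 0 (2 * Real.pi), ∫⁻ w in Ω, ‖f w‖ₑ ^ 2 := lintegral_mono fun θ => hrot θ
      _ = _ := by simp
  rw [mul_right_comm] at hI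
  exact (ENNReal.mul_le_mul_iff_left (by simpa using Real.pi_pos) ENNReal.ofReal_ne_top).1 hI

/-- Point evaluations are bounded on `A²(Ω)`, locally uniformly. -/
theorem bergman_eval_bound (n : ℕ) {r : ℝ} (hr : 0 < r) : ∃ C : ℝ, 0 ≤ C ∧
    ∀ {Ω : Set (Fin n → ℂ)}, IsOpen Ω → ∀ {f : (Fin n → ℂ) → ℂ}, MemBergman Ω 2 f →
      ∀ {z}, Metric.closedBall z r ⊆ Ω →
        ‖f z‖ ≤ C * (eLpNorm f 2 (volume.restrict Ω)).toReal := by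
  set V := volume (Metric.closedBall (0 : Fin n → ℂ) r) with hV
  have hV0 : V ≠ 0 := (Metric.measure_closedBall_pos _ _ hr).ne'
  have hVt : V ≠ ⊤ := (isCompact_closedBall _ _).measure_lt_top.ne
  have hVpos : 0 < V.toReal := ENNReal.toReal_pos hV0 hVt
  refine ⟨(Real.sqrt V.toReal)⁻¹, by positivity, ?_⟩
  intro Ω hΩ f hf z hz
  have h := bergman_eval_sq hf.1 hz
  have hN : ∫⁻ w in Ω, ‖f w‖ₑ ^ 2 = eLpNorm f 2 (volume.restrict Ω) ^ 2 := by
    rw [eLpNorm_eq_lintegral_rpow_enorm_toReal two_ne_zero ENNReal.ofNat_ne_top]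
    simp only [ENNReal.toReal_ofNat, ENNReal.rpow_ofNat]
    rw [← ENNReal.rpow_ofNat, ← ENNReal.rpow_mul]
    norm_num
  rw [hN] at h
  have h2 := ENNReal.toReal_mono (ENNReal.pow_ne_top hf.2.2.ne) h
  simp only [ENNReal.toReal_mul, ENNReal.toReal_pow, toReal_enorm] at h2
  rw [inv_mul_eq_div, le_div_iff₀ (by positivity)]
  refine le_of_sq_le_sq ?_ ENNReal.toReal_nonneg
  rw [mul_pow, Real.sq_sqrt hVpos.le]
  exact h2

theorem bergman_fderiv_bound (n : ℕ) {r : ℝ} (hr : 0 < r) : ∃ C : ℝ, 0 ≤ C ∧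
    ∀ {Ω : Set (Fin n → ℂ)}, IsOpen Ω → ∀ {f : (Fin n → ℂ) → ℂ}, MemBergman Ω 2 f →
      ∀ {z}, Metric.closedBall z (2 * r) ⊆ Ω →
        ‖fderiv ℂ f z‖ ≤ C * (eLpNorm f 2 (volume.restrict Ω)).toReal := by
  obtain ⟨C, hC, hev⟩ := bergman_eval_bound n hr
  refine ⟨C / r, by positivity, ?_⟩
  intro Ω hΩ f hf z hz
  set N := (eLpNorm f 2 (volume.restrict Ω)).toReal with hN
  have hN0 : 0 ≤ N := ENNReal.toReal_nonneg
  have hsup : ∀ y ∈ Metric.closedBall z r, ‖f y‖ ≤ C * N := by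
    intro y hy
    refine hev hΩ hf ((Metric.closedBall_subset_closedBall' ?_).trans hz)
    rw [Metric.mem_closedBall] at hy
    linarith
  have hzΩ : ∀ y ∈ Metric.closedBall z r, DifferentiableAt ℂ f y := fun y hy =>
    hf.1.differentiableAt (hΩ.mem_nhds (hz (Metric.closedBall_subset_closedBall (by linarith) hy)))
  refine ContinuousLinearMap.opNorm_le_bound _ (by positivity) fun v => ?_
  rcases eq_or_ne v 0 with rfl | hv
  · simp
  have hv' : 0 < ‖v‖ := norm_pos_iff.2 hv
  have hz0 : z ∈ Metric.closedBall z r := Metric.mem_closedBall_self hr.le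
  have hin : ∀ c ∈ Metric.closedBall (0 : ℂ) (r / ‖v‖), z + c • v ∈ Metric.closedBall z r := by
    intro c hc
    rw [mem_closedBall_zero_iff, le_div_iff₀ hv'] at hc
    rwa [mem_closedBall_iff_norm, add_sub_cancel_left, norm_smul]
  have hline : ∀ c : ℂ, HasDerivAt (fun c : ℂ => z + c • v) v c := fun c => by
    simpa using ((hasDerivAt_id c).smul_const v).const_add z
  have hder : HasDerivAt (fun c : ℂ => f (z + c • v)) (fderiv ℂ f z v) 0 := by
    have h1 : HasFDerivAt f (fderiv ℂ f z) (z + (0 : ℂ) • v) := by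
      simpa using (hzΩ z hz0).hasFDerivAt
    exact h1.comp_hasDerivAt (0 : ℂ) (hline 0)
  have hdiff : DifferentiableOn ℂ (fun c : ℂ => f (z + c • v))
      (Metric.closedBall (0 : ℂ) (r / ‖v‖)) := fun c hc =>
    ((hzΩ _ (hin c hc)).comp c (hline c).differentiableAt).differentiableWithinAt
  have := Complex.norm_deriv_le_of_forall_mem_sphere_norm_le (by positivity : 0 < r / ‖v‖)
    (hdiff.diffContOnCl_ball subset_rfl)
    (fun c hc => hsup _ (hin c (Metric.sphere_subset_closedBall hc)))
  rw [hder.deriv] at this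
  refine this.trans (le_of_eq ?_)
  field_simp

/-- The Bergman space `A²(Ω)` as a subspace of the Hilbert space `L²(Ω)`. -/
def bergmanSubmodule {n : ℕ} (Ω : Set (Fin n → ℂ)) :
    Submodule ℂ (Lp ℂ 2 (volume.restrict Ω)) where
  carrier := {g | ∃ f, MemBergman Ω 2 f ∧ g =ᵐ[volume.restrict Ω] f}
  add_mem' := by
    rintro g g' ⟨f, hf, h⟩ ⟨f', hf', h'⟩
    exact ⟨f + f', ⟨hf.1.add hf'.1, hf.2.add hf'.2⟩, (Lp.coeFn_add g g').trans (h.add h')⟩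
  zero_mem' := ⟨0, ⟨differentiableOn_const 0, MemLp.zero⟩, Lp.coeFn_zero _ _ _⟩
  smul_mem' := by
    rintro c g ⟨f, hf, h⟩
    exact ⟨c • f, ⟨hf.1.const_smul c, hf.2.const_smul c⟩,
      (Lp.coeFn_smul c g).trans (h.const_smul c)⟩

theorem bergman_norm_eq {n : ℕ} {Ω : Set (Fin n → ℂ)} {g : Lp ℂ 2 (volume.restrict Ω)}
    {f : (Fin n → ℂ) → ℂ} (h : g =ᵐ[volume.restrict Ω] f) :
    (eLpNorm f 2 (volume.restrict Ω)).toReal = ‖g‖ := by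
  rw [Lp.norm_def, eLpNorm_congr_ae h]

theorem bergman_isClosed {n : ℕ} {Ω : Set (Fin n → ℂ)} (hΩ : IsOpen Ω) :
    IsClosed (bergmanSubmodule Ω : Set (Lp ℂ 2 (volume.restrict Ω))) := by
  refine isClosed_of_closure_subset fun g hg => ?_
  obtain ⟨u, hu, hlim⟩ := mem_closure_iff_seq_limit.1 hg
  choose f hf hfu using hu
  have hdist : ∀ j k, MemBergman Ω 2 (f j - f k) ∧
      (eLpNorm (f j - f k) 2 (volume.restrict Ω)).toReal = ‖u j - u k‖ := fun j k =>
    ⟨⟨(hf j).1.sub (hf k).1, (hf j).2.sub (hf k).2⟩,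
      bergman_norm_eq ((Lp.coeFn_sub _ _).trans ((hfu j).sub (hfu k)))⟩
  have hcau : ∀ ε > 0, ∃ M, ∀ j ≥ M, ∀ k ≥ M, ‖u j - u k‖ < ε := by
    simpa [dist_eq_norm] using Metric.cauchySeq_iff.1 hlim.cauchySeq
  have hball : ∀ z ∈ Ω, ∃ r > 0, Metric.closedBall z (4 * r) ⊆ Ω := by
    intro z hz
    obtain ⟨ε, hε, h⟩ := Metric.nhds_basis_closedBall.mem_iff.1 (hΩ.mem_nhds hz)
    exact ⟨ε / 4, by positivity, by rwa [mul_div_cancel₀ _ four_ne_zero]⟩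
  have hsmul : ∀ C : ℝ, 0 ≤ C → ∀ ε > 0, ∃ M, ∀ j ≥ M, ∀ k ≥ M, C * ‖u j - u k‖ < ε := by
    intro C hC ε hε
    obtain ⟨M, hM⟩ := hcau (ε / (C + 1)) (by positivity)
    refine ⟨M, fun j hj k hk => ?_⟩
    have := hM j hj k hk
    rw [lt_div_iff₀ (by positivity)] at this
    nlinarith [norm_nonneg (u j - u k)]
  -- pointwise limits
  have hpt : ∀ z, ∃ c, z ∈ Ω → Tendsto (fun j => f j z) atTop (𝓝 c) := by
    intro z
    by_cases hz : z ∈ Ω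
    · obtain ⟨r, hr, hrz⟩ := hball z hz
      obtain ⟨C, hC, hev⟩ := bergman_eval_bound n hr
      have hc : CauchySeq fun j => f j z := by
        rw [Metric.cauchySeq_iff]
        intro ε hε
        obtain ⟨M, hM⟩ := hsmul C hC ε hε
        refine ⟨M, fun j hj k hk => lt_of_le_of_lt ?_ (hM j hj k hk)⟩
        rw [dist_eq_norm, ← (hdist j k).2]
        exact hev hΩ (hdist j k).1
          ((Metric.closedBall_subset_closedBall (by linarith)).trans hrz)
      obtain ⟨c, hc⟩ := cauchySeq_tendsto_of_complete hc
      exact ⟨c, fun _ => hc⟩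
    · exact ⟨0, fun h => absurd h hz⟩
  choose F hF using hpt
  have hdif : DifferentiableOn ℂ F Ω := by
    intro z hz
    obtain ⟨r, hr, hrz⟩ := hball z hz
    obtain ⟨C, hC, hev⟩ := bergman_fderiv_bound n hr
    have hsub : ∀ y ∈ Metric.ball z r, Metric.closedBall y (2 * r) ⊆ Ω := fun y hy =>
      (Metric.closedBall_subset_closedBall' (by
        rw [Metric.mem_ball] at hy; linarith)).trans hrz
    have hyΩ : ∀ y ∈ Metric.ball z r, y ∈ Ω := fun y hy =>
      hsub y hy (Metric.mem_closedBall_self (by positivity))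
    have hat : ∀ j, ∀ y ∈ Metric.ball z r, DifferentiableAt ℂ (f j) y := fun j y hy =>
      (hf j).1.differentiableAt (hΩ.mem_nhds (hyΩ y hy))
    have huc : UniformCauchySeqOn (fun j => fderiv ℂ (f j)) atTop (Metric.ball z r) := by
      rw [Metric.uniformCauchySeqOn_iff]
      intro ε hε
      obtain ⟨M, hM⟩ := hsmul C hC ε hε
      refine ⟨M, fun j hj k hk y hy => lt_of_le_of_lt ?_ (hM j hj k hk)⟩
      rw [dist_eq_norm, ← (hdist j k).2, ← fderiv_sub (hat j y hy) (hat k y hy)]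
      exact hev hΩ (hdist j k).1 (hsub y hy)
    have hex : ∀ y, ∃ A, y ∈ Metric.ball z r →
        Tendsto (fun j => fderiv ℂ (f j) y) atTop (𝓝 A) := by
      intro y
      by_cases hy : y ∈ Metric.ball z r
      · obtain ⟨A, hA⟩ := cauchySeq_tendsto_of_complete (huc.cauchySeq hy)
        exact ⟨A, fun _ => hA⟩
      · exact ⟨0, fun h => absurd h hy⟩
    choose A hA using hex
    have hunif := huc.tendstoUniformlyOn_of_tendsto (fun y hy => hA y hy)
    exact (hasFDerivAt_of_tendstoUniformlyOn Metric.isOpen_ball hunif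
      (fun j y hy => (hat j y hy).hasFDerivAt) (fun y hy => hF y (hyΩ y hy))
      (Metric.mem_ball_self hr)).differentiableAt.differentiableWithinAt
  -- the pointwise limit represents the limit in `L²`
  have hae : g =ᵐ[volume.restrict Ω] F := by
    have hm := tendstoInMeasure_of_tendsto_Lp hlim
    obtain ⟨ns, hns, hsub⟩ := hm.exists_seq_tendsto_ae
    have hall : ∀ᵐ x ∂(volume.restrict Ω), ∀ j, u j x = f j x := ae_all_iff.2 hfu
    filter_upwards [hsub, hall, ae_restrict_mem hΩ.measurableSet] with x hx hx' hxΩ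
    refine tendsto_nhds_unique hx ?_
    simp only [hx']
    exact (hF x hxΩ).comp hns.tendsto_atTop
  exact ⟨F, ⟨hdif, (memLp_congr_ae hae).1 (Lp.memLp g)⟩, hae⟩

/-- Every open set of `ℂⁿ` has a Bergman kernel. -/
theorem exists_isBergmanKernel {n : ℕ} {Ω : Set (Fin n → ℂ)} (hΩ : IsOpen Ω) :
    ∃ K, IsBergmanKernel Ω K := by
  have : CompleteSpace (bergmanSubmodule Ω) := (bergman_isClosed hΩ).completeSpace_coe
  choose rep hrep hrepu using fun g : bergmanSubmodule Ω => g.2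
  have hev : ∀ z ∈ Ω, ∃ C : ℝ, ∀ f, MemBergman Ω 2 f →
      ‖f z‖ ≤ C * (eLpNorm f 2 (volume.restrict Ω)).toReal := by
    intro z hz
    obtain ⟨ε, hε, h⟩ := Metric.nhds_basis_closedBall.mem_iff.1 (hΩ.mem_nhds hz)
    obtain ⟨C, -, hC⟩ := bergman_eval_bound n hε
    exact ⟨C, fun f hf => hC hΩ hf h⟩
  have huniq : ∀ z ∈ Ω, ∀ f f', MemBergman Ω 2 f → MemBergman Ω 2 f' →
      f =ᵐ[volume.restrict Ω] f' → f z = f' z := by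
    intro z hz f f' hf hf' h
    obtain ⟨C, hC⟩ := hev z hz
    have h0 : eLpNorm (f - f') 2 (volume.restrict Ω) = 0 := by
      rw [eLpNorm_eq_zero_iff (hf.2.sub hf'.2).1 two_ne_zero]
      filter_upwards [h] with x hx
      simp [hx]
    have := hC (f - f') ⟨hf.1.sub hf'.1, hf.2.sub hf'.2⟩
    rw [h0, ENNReal.toReal_zero, mul_zero, norm_le_zero_iff] at this
    exact sub_eq_zero.1 this
  have hk : ∀ z, ∃ k : bergmanSubmodule Ω, z ∈ Ω → ∀ g, inner ℂ k g = rep g z := by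
    intro z
    by_cases hz : z ∈ Ω
    · obtain ⟨C, hC⟩ := hev z hz
      let L : bergmanSubmodule Ω →ₗ[ℂ] ℂ :=
        { toFun := fun g => rep g z
          map_add' := fun g g' => by
            refine huniq z hz _ (rep g + rep g') (hrep _)
              ⟨(hrep g).1.add (hrep g').1, (hrep g).2.add (hrep g').2⟩ ?_
            exact (hrepu (g + g')).symm.trans ((Lp.coeFn_add _ _).trans
              ((hrepu g).add (hrepu g')))
          map_smul' := fun c g => by
            refine huniq z hz _ (c • rep g) (hrep _)
              ⟨(hrep g).1.const_smul c, (hrep g).2.const_smul c⟩ ?_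
            exact (hrepu (c • g)).symm.trans ((Lp.coeFn_smul _ _).trans
              ((hrepu g).const_smul c)) }
      let L' : bergmanSubmodule Ω →L[ℂ] ℂ := L.mkContinuous C fun g => by
        have := hC _ (hrep g)
        rw [bergman_norm_eq (hrepu g)] at this
        exact this
      exact ⟨(InnerProductSpace.toDual ℂ _).symm L', fun _ g => by
        rw [InnerProductSpace.toDual_symm_apply]; rfl⟩
    · exact ⟨0, fun h => absurd h hz⟩
  choose k hk using hk
  refine ⟨fun z w => (starRingEnd ℂ) (rep (k z) w), fun z hz => ⟨?_, ?_⟩⟩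
  · simpa using hrep (k z)
  · intro f hf
    let g : bergmanSubmodule Ω := ⟨hf.2.toLp f, f, hf, hf.2.coeFn_toLp⟩
    have h1 : f z = rep g z :=
      huniq z hz _ _ hf (hrep g) (hf.2.coeFn_toLp.symm.trans (hrepu g))
    rw [h1, ← hk z hz g, Submodule.coe_inner, L2.inner_def]
    refine integral_congr_ae ?_
    filter_upwards [hrepu (k z), hf.2.coeFn_toLp] with w hw hw'
    have hg : ((g : Lp ℂ 2 (volume.restrict Ω)) : (Fin n → ℂ) → ℂ) w = f w := hw'
    rw [hw, hg]
    simp [mul_comm]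

/-- A kernel is determined on `Ω × Ω` by the reproducing property. -/
theorem IsBergmanKernel.eq_on {n : ℕ} {Ω : Set (Fin n → ℂ)}
    {K K' : (Fin n → ℂ) → (Fin n → ℂ) → ℂ} (h : IsBergmanKernel Ω K) (h' : IsBergmanKernel Ω K')
    {z w : Fin n → ℂ} (hz : z ∈ Ω) (hw : w ∈ Ω) : K z w = K' z w := by
  have e1 := (h w hw).2 _ (h' z hz).1
  have e2 := (h' z hz).2 _ (h w hw).1
  have e3 : (starRingEnd ℂ) (K w z) = K' z w := by
    have := congrArg (starRingEnd ℂ) e1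
    rw [Complex.conj_conj, ← integral_conj] at this
    rw [this, e2]
    refine integral_congr_ae (Eventually.of_forall fun v => ?_)
    simp [mul_comm]
  have e4 : (starRingEnd ℂ) (K w z) = K z w := by
    have e1 := (h w hw).2 _ (h z hz).1
    have e2 := (h z hz).2 _ (h w hw).1
    have := congrArg (starRingEnd ℂ) e1
    rw [Complex.conj_conj, ← integral_conj] at this
    rw [this, e2]
    refine integral_congr_ae (Eventually.of_forall fun v => ?_)
    simp [mul_comm]
  rw [← e4, e3]

/-- The Bergman kernel `B_Ω(z, w)` of an open set `Ω`; only its values on `Ω × Ω`, which are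
uniquely determined, are ever used. -/
def bergmanKernel {n : ℕ} {Ω : Set (Fin n → ℂ)} (hΩ : IsOpen Ω) :
    (Fin n → ℂ) → (Fin n → ℂ) → ℂ :=
  (exists_isBergmanKernel hΩ).choose

theorem bergmanKernel_spec {n : ℕ} {Ω : Set (Fin n → ℂ)} (hΩ : IsOpen Ω) :
    IsBergmanKernel Ω (bergmanKernel hΩ) :=
  (exists_isBergmanKernel hΩ).choose_spec

/-- The integral defining `𝐁f(z)` converges (absolutely). -/
def BergmanConverges {n : ℕ} {Ω : Set (Fin n → ℂ)} (hΩ : IsOpen Ω) (f : (Fin n → ℂ) → ℂ)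
    (z : Fin n → ℂ) : Prop :=
  IntegrableOn (fun w => bergmanKernel hΩ z w * f w) Ω volume

/-- `𝐁f(z) = ∫_Ω B(z, w) f(w) dV(w)`. -/
def bergmanProj {n : ℕ} {Ω : Set (Fin n → ℂ)} (hΩ : IsOpen Ω) (f : (Fin n → ℂ) → ℂ)
    (z : Fin n → ℂ) : ℂ :=
  ∫ w in Ω, bergmanKernel hΩ z w * f w

/-- `|𝐁|f(z) = ∫_Ω |B(z, w)| f(w) dV(w)`. -/
def absBergman {n : ℕ} {Ω : Set (Fin n → ℂ)} (hΩ : IsOpen Ω) (f : (Fin n → ℂ) → ℂ)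
    (z : Fin n → ℂ) : ℂ :=
  ∫ w in Ω, (‖bergmanKernel hΩ z w‖ : ℂ) * f w

/-- `|𝐁|` is bounded on `L^p(Ω)`: for every `f ∈ L^p(Ω)` the integral `|𝐁|f(z)` converges for almost
every `z ∈ Ω`, and `‖|𝐁|f‖_p ≤ C ‖f‖_p` with `C` independent of `f`. -/
def AbsBergmanBounded {n : ℕ} {Ω : Set (Fin n → ℂ)} (hΩ : IsOpen Ω) (p : ℝ≥0∞) : Prop :=
  ∃ C : ℝ≥0, ∀ f : (Fin n → ℂ) → ℂ, MemLp f p (volume.restrict Ω) →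
    (∀ᵐ z ∂(volume.restrict Ω),
      IntegrableOn (fun w => (‖bergmanKernel hΩ z w‖ : ℂ) * f w) Ω volume) ∧
    eLpNorm (absBergman hΩ f) p (volume.restrict Ω) ≤ C * eLpNorm f p (volume.restrict Ω)

/-- A bounded Reinhardt domain in `ℂⁿ`. -/
structure IsBoundedReinhardtDomain {n : ℕ} (R : Set (Fin n → ℂ)) : Prop where
  isOpen : IsOpen R
  isConnected : IsConnected R
  isBounded : Bornology.IsBounded R
  rotate_mem : ∀ z ∈ R, ∀ θ : Fin n → ℝ,
    (fun j => Complex.exp ((θ j : ℂ) * Complex.I) * z j) ∈ R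

/-- The monomial `e_α(z) = z₁^α₁ ⋯ zₙ^αₙ`, `α ∈ ℤⁿ`. -/
def laurentMonomial {n : ℕ} (α : Fin n → ℤ) (z : Fin n → ℂ) : ℂ := ∏ j, z j ^ α j

/-- The set `𝒮(R, L^p)` of `L^p`-allowable multi-indices. (If `R` meets `{z_j = 0}` and `α_j < 0`,
then `e_α`, whatever its values there, is not holomorphic on `R`, so `α` is not allowable.) -/
def allowable {n : ℕ} (R : Set (Fin n → ℂ)) (p : ℝ≥0∞) : Set (Fin n → ℤ) :=
  {α | MemBergman R p (laurentMonomial α)}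

/-- `f = ∑_{α ∈ ℤⁿ} a_α e_α`, uniformly on compact subsets of `R`. -/
def IsLaurentExpansion {n : ℕ} (R : Set (Fin n → ℂ)) (f : (Fin n → ℂ) → ℂ)
    (a : (Fin n → ℤ) → ℂ) : Prop :=
  ∀ K ⊆ R, IsCompact K → HasSumUniformlyOn (fun α z => a α * laurentMonomial α z) f K

/-- The square partial sum `∑_{|α|_∞ ≤ N} b_α e_α`. -/
def squarePartialSum {n : ℕ} (N : ℕ) (b : (Fin n → ℤ) → ℂ) (z : Fin n → ℂ) : ℂ :=
  ∑ α ∈ Fintype.piFinset (fun _ : Fin n => Finset.Icc (-(N : ℤ)) (N : ℤ)),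
    b α * laurentMonomial α z

end

/-! The torus acts on `R` by measure-preserving rotations, and everything is read off from this
action. The weight-`α` component of a holomorphic `f` (`torusComponent`) is holomorphic. Its product
with `e_{-α}` is invariant under rotations, hence locally constant off the coordinate hyperplanes,
so the identity theorem makes the component a multiple `a_α e_α` on all of `R`
(`exists_torusComponent_eq`). Along the orbit of a point `z` the function `θ ↦ f (θ · z)` is a
Fourier series with coefficients `a_α e_α(z)`. Cauchy estimates make it absolutely convergent,
locally uniformly in `z`, and this is the Laurent expansion. Averaging over orbits does not increase
`L^p` norms, so `a_α e_α` is in `L^p` whenever `f` is; hence `a_α = 0` when `α` is not allowable.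

For the projection, the orbit average of `w ↦ B(z, w) e_γ(w)` is `e_γ(w)` times the conjugate of the
weight-`γ` component of `conj B(z, ·)`. The latter function lies in `A²`, so the component vanishes
if `e_γ` is not in `A²`, and `𝐁 e_γ = 0` as soon as the integral converges. If `e_γ` is in `A²`, it
is reproduced. Thus `𝐁` acts on a Laurent polynomial with `L^p`-allowable exponents by deleting the
terms that are not in `L²`.

It remains to pass to the limit. By the M. Riesz theorem on the circle, applied in one coordinate at
a time, square partial sums are uniformly bounded in `L^p` of the torus. Integrating over orbits
with dominated convergence gives `S_N f → f` in `L^p(R)` (`tendsto_eLpNorm_squarePartialSum_sub`),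
and `L^p` boundedness of `𝐁`, which follows from that of `|𝐁|`, carries this over to `𝐁 f`.

The hypothesis gives convergence of the integrals only for almost every `z`. The kernel is
holomorphic in `z`, so the mean value inequality on a polydisc bounds the absolute integral at any
`z` by the double integral over `R × R`, which is finite (`AbsBergmanBounded.bergmanConverges`). -/

/-! ### The M. Riesz theorem on the circle for `1 < p < 2` -/

/-- For `1 < q < 2` and `Re z > 0`, `|z| ^ q` is dominated by `(Re z) ^ q` up to a multiple of
`Re (z ^ q)`. -/
theorem exists_norm_rpow_le_re_rpow_sub {q : ℝ} (h1 : 1 < q) (h2 : q < 2) :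
    ∃ A B : ℝ, 0 ≤ A ∧ 0 ≤ B ∧ ∀ z : ℂ, 0 < z.re →
      ‖z‖ ^ q ≤ A * z.re ^ q - B * (z ^ (q : ℂ)).re := by
  have hpi := Real.pi_pos
  -- The angle `φ` satisfies `φ < π / 2` and `π / 2 < φ q < π`. For `|arg z| ≤ φ` the term with `cos
  -- (arg z) ^ q` dominates. For `φ < |arg z| < π / 2` the angle `q |arg z|` lies between `φ q` and
  -- `π`, where the cosine is at most `cos (φ q) < 0`. The choice of `B` normalises `B cos (φ q) =
  -- -1`.
  set φ : ℝ := Real.pi * (q + 1) / (4 * q) with hφ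
  have hφq : φ * q = Real.pi * (q + 1) / 4 := by rw [hφ]; field_simp
  have hφ2 : φ < Real.pi / 2 := by
    rw [hφ, div_lt_div_iff₀ (by positivity) (by positivity)]; nlinarith
  have hφ0 : 0 < φ := by positivity
  have hc : 0 < Real.cos φ := Real.cos_pos_of_mem_Ioo ⟨by linarith, hφ2⟩
  have hn : Real.cos (φ * q) < 0 := by
    rw [hφq]
    exact Real.cos_neg_of_pi_div_two_lt_of_lt (by nlinarith) (by nlinarith)
  set B : ℝ := (-Real.cos (φ * q))⁻¹ with hB
  have hB0 : 0 < B := inv_pos.2 (by linarith)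
  have hcq : 0 < Real.cos φ ^ q := Real.rpow_pos_of_pos hc q
  refine ⟨(1 + B) / Real.cos φ ^ q, B, by positivity, hB0.le, fun z hz => ?_⟩
  have hz0 : z ≠ 0 := by rintro rfl; simp at hz
  have hzn : 0 < ‖z‖ := norm_pos_iff.2 hz0
  have hre : z.re = ‖z‖ * Real.cos z.arg := by
    rw [Complex.cos_arg hz0]; field_simp
  have harg : |z.arg| < Real.pi / 2 := Complex.abs_arg_lt_pi_div_two_iff.2 (Or.inl hz)
  have hcos : 0 < Real.cos z.arg := by
    rw [← Real.cos_abs]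
    exact Real.cos_pos_of_mem_Ioo ⟨by linarith [abs_nonneg z.arg], harg⟩
  rw [Complex.cpow_ofReal_re, hre, Real.mul_rpow hzn.le hcos.le]
  have key : 1 ≤ (1 + B) / Real.cos φ ^ q * Real.cos z.arg ^ q - B * Real.cos (z.arg * q) := by
    have habs : Real.cos (z.arg * q) = Real.cos (|z.arg| * q) := by
      rw [← Real.cos_abs, abs_mul, abs_of_pos (by linarith : (0 : ℝ) < q)]
    rcases le_or_gt |z.arg| φ with h | h
    · have : Real.cos φ ≤ Real.cos z.arg := by
        rw [← Real.cos_abs z.arg]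
        exact Real.cos_le_cos_of_nonneg_of_le_pi (abs_nonneg _) (by linarith) h
      have h3 : Real.cos φ ^ q ≤ Real.cos z.arg ^ q :=
        Real.rpow_le_rpow hc.le this (by linarith)
      have h4 : 1 + B ≤ (1 + B) / Real.cos φ ^ q * Real.cos z.arg ^ q := by
        rw [div_mul_eq_mul_div, le_div_iff₀ hcq]
        gcongr
      nlinarith [Real.cos_le_one (z.arg * q)]
    · have h3 : Real.cos (|z.arg| * q) ≤ Real.cos (φ * q) :=
        Real.cos_le_cos_of_nonneg_of_le_pi (by positivity) (by nlinarith) (by nlinarith)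
      have h4 : B * Real.cos (φ * q) = -1 := by
        rw [hB, inv_neg, neg_mul, inv_mul_cancel₀ hn.ne]
      have h5 : 0 ≤ (1 + B) / Real.cos φ ^ q * Real.cos z.arg ^ q := by positivity
      rw [habs]
      nlinarith
  have := mul_le_mul_of_nonneg_left key (Real.rpow_nonneg hzn.le q)
  calc ‖z‖ ^ q = ‖z‖ ^ q * 1 := (mul_one _).symm
    _ ≤ _ := this
    _ = _ := by ring

theorem unitAddCircle_integral_comp_toCircle {g : ℂ → ℂ}
    (hg : DiffContOnCl ℂ g (Metric.ball 0 1)) :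
    ∫ x : UnitAddCircle, g (x.toCircle : ℂ) ∂AddCircle.haarAddCircle = g 0 := by
  have h : Real.circleAverage g 0 1 = g 0 := DiffContOnCl.circleAverage (by simpa using hg)
  have hv : (AddCircle.haarAddCircle : Measure UnitAddCircle) = volume := by
    rw [AddCircle.volume_eq_smul_haarAddCircle]; simp
  rw [hv, ← UnitAddCircle.intervalIntegral_preimage 0, ← h, Real.circleAverage]
  have hs := intervalIntegral.smul_integral_comp_mul_left (a := 0) (b := 1)
    (fun θ => g (circleMap 0 1 θ)) (2 * Real.pi)
  rw [mul_zero, mul_one] at hs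
  rw [← hs, smul_smul, inv_mul_cancel₀ (by positivity), one_smul, zero_add]
  refine intervalIntegral.integral_congr fun t _ => ?_
  simp [AddCircle.toCircle_apply_mk, circleMap, Circle.coe_exp]

theorem integrable_of_continuous_circle {E : Type*} [NormedAddCommGroup E]
    {g : UnitAddCircle → E} (hg : Continuous g) : Integrable g AddCircle.haarAddCircle :=
  hg.integrable_of_hasCompactSupport (HasCompactSupport.of_compactSpace g)

theorem continuous_toCircle_coe : Continuous fun x : UnitAddCircle => (x.toCircle : ℂ) :=
  continuous_subtype_val.comp AddCircle.continuous_toCircle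

theorem Complex.exists_toCircle_eq {z : ℂ} (hz : ‖z‖ = 1) :
    ∃ x : UnitAddCircle, (x.toCircle : ℂ) = z := by
  obtain ⟨x, hx⟩ := (AddCircle.homeomorphCircle (one_ne_zero : (1 : ℝ) ≠ 0)).surjective
    ⟨z, by simpa [Submonoid.unitSphere] using hz⟩
  refine ⟨x, ?_⟩
  rw [AddCircle.homeomorphCircle_apply] at hx
  rw [hx]

/-- When `F` has positive real part on the closed disc, `F ^ q` is holomorphic there, and the mean
of its real part over the circle is `Re (F(0) ^ q)`. This is nonnegative because `F(0)` is real and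
positive. Integrating the pointwise inequality, the term with `B` can therefore be dropped. -/
theorem integral_norm_rpow_le_integral_re_rpow {q A B : ℝ} (hB : 0 ≤ B) (hq : 1 < q)
    (hAB : ∀ z : ℂ, 0 < z.re → ‖z‖ ^ q ≤ A * z.re ^ q - B * (z ^ (q : ℂ)).re)
    {F : ℂ → ℂ} (hF : Differentiable ℂ F) {δ : ℝ} (hδ : 0 < δ)
    (hre : ∀ x : UnitAddCircle, δ ≤ (F x.toCircle).re) (h0 : (F 0).im = 0) :
    ∫ x : UnitAddCircle, ‖F x.toCircle‖ ^ q ∂AddCircle.haarAddCircle ≤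
      A * ∫ x : UnitAddCircle, (F x.toCircle).re ^ q ∂AddCircle.haarAddCircle := by
  have hpos : ∀ z ∈ Metric.closedBall (0 : ℂ) 1, 0 < (F z).re := by
    intro z hz
    -- The maximum principle for `exp (-F)`, whose modulus is `exp (-Re F)`, carries the lower bound
    -- `δ` on `Re F` from the circle into the disc.
    have hd : Differentiable ℂ fun z => Complex.exp (-F z) := by fun_prop
    have := Complex.norm_le_of_forall_mem_frontier_norm_le (C := Real.exp (-δ))
      (Metric.isBounded_ball (x := (0 : ℂ)) (r := 1)) hd.diffContOnCl (fun w hw => by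
        rw [frontier_ball _ one_ne_zero, mem_sphere_zero_iff_norm] at hw
        obtain ⟨x, rfl⟩ := Complex.exists_toCircle_eq hw
        rw [Complex.norm_exp, Real.exp_le_exp, Complex.neg_re, neg_le_neg_iff]
        exact hre x) (by rwa [closure_ball _ one_ne_zero])
    rw [Complex.norm_exp, Real.exp_le_exp, Complex.neg_re, neg_le_neg_iff] at this
    linarith
  have hd : DifferentiableOn ℂ (fun z => F z ^ (q : ℂ)) (Metric.closedBall 0 1) := fun z hz =>
    ((hF z).cpow_const (Or.inl (hpos z hz))).differentiableWithinAt
  have hmean := unitAddCircle_integral_comp_toCircle (hd.diffContOnCl_ball subset_rfl)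
  have hc : Continuous fun x : UnitAddCircle => F x.toCircle :=
    hF.continuous.comp continuous_toCircle_coe
  have hmem : ∀ x : UnitAddCircle, (x.toCircle : ℂ) ∈ Metric.closedBall (0 : ℂ) 1 := fun x => by
    rw [mem_closedBall_zero_iff]; exact (Circle.norm_coe _).le
  have hcq : Continuous fun x : UnitAddCircle => F x.toCircle ^ (q : ℂ) :=
    hd.continuousOn.comp_continuous continuous_toCircle_coe hmem
  have hre0 : 0 ≤ ∫ x : UnitAddCircle, (F x.toCircle ^ (q : ℂ)).re ∂AddCircle.haarAddCircle := by
    have : ∫ x : UnitAddCircle, (F x.toCircle ^ (q : ℂ)).re ∂AddCircle.haarAddCircle =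
        (F 0 ^ (q : ℂ)).re := by
      rw [← hmean]
      exact Complex.reCLM.integral_comp_comm (integrable_of_continuous_circle hcq)
    rw [this, Complex.cpow_ofReal_re]
    have : (F 0).arg = 0 := Complex.arg_eq_zero_iff.2
      ⟨(hpos 0 (by simp)).le, h0⟩
    rw [this, zero_mul, Real.cos_zero, mul_one]
    positivity
  have hcre : Continuous fun x : UnitAddCircle => (F x.toCircle).re ^ q :=
    (Complex.continuous_re.comp hc).rpow_const fun x => Or.inr (by linarith)
  have hcre' : Continuous fun x : UnitAddCircle => (F x.toCircle ^ (q : ℂ)).re :=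
    Complex.continuous_re.comp hcq
  calc ∫ x : UnitAddCircle, ‖F x.toCircle‖ ^ q ∂AddCircle.haarAddCircle
      ≤ ∫ x : UnitAddCircle, (A * (F x.toCircle).re ^ q - B * (F x.toCircle ^ (q : ℂ)).re)
          ∂AddCircle.haarAddCircle := by
        refine integral_mono (integrable_of_continuous_circle ?_)
          (integrable_of_continuous_circle (by fun_prop)) fun x => hAB _ (hpos _ (hmem x))
        exact hc.norm.rpow_const fun x => Or.inr (by linarith)
    _ = A * ∫ x : UnitAddCircle, (F x.toCircle).re ^ q ∂AddCircle.haarAddCircle -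
          B * ∫ x : UnitAddCircle, (F x.toCircle ^ (q : ℂ)).re ∂AddCircle.haarAddCircle := by
        rw [integral_sub ((integrable_of_continuous_circle hcre).const_mul A)
          ((integrable_of_continuous_circle hcre').const_mul B),
          integral_const_mul, integral_const_mul]
    _ ≤ _ := by nlinarith

theorem Real.add_rpow_le_two_rpow_mul {a b q : ℝ} (ha : 0 ≤ a) (hb : 0 ≤ b) (hq : 0 ≤ q) :
    (a + b) ^ q ≤ 2 ^ q * (a ^ q + b ^ q) := by
  have hm : 0 ≤ max a b := le_max_of_le_left ha
  calc (a + b) ^ q ≤ (2 * max a b) ^ q :=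
        Real.rpow_le_rpow (by positivity) (by linarith [le_max_left a b, le_max_right a b]) hq
    _ = 2 ^ q * max a b ^ q := Real.mul_rpow (by norm_num) hm
    _ ≤ 2 ^ q * (a ^ q + b ^ q) := by
        gcongr
        rcases max_choice a b with h | h <;> rw [h]
        · linarith [Real.rpow_nonneg hb q]
        · linarith [Real.rpow_nonneg ha q]

/-- The holomorphic monomial whose real part on the unit circle is that of `b * z ^ k`. -/
noncomputable def analyticTerm (k : ℤ) (b z : ℂ) : ℂ :=
  if k = 0 then (b.re : ℂ) else if 0 < k then b * z ^ k.toNat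
    else (starRingEnd ℂ) b * z ^ (-k).toNat

theorem differentiable_analyticTerm (k : ℤ) (b : ℂ) : Differentiable ℂ (analyticTerm k b) := by
  unfold analyticTerm
  split_ifs <;> fun_prop

theorem analyticTerm_zero_im (k : ℤ) (b : ℂ) : (analyticTerm k b 0).im = 0 := by
  unfold analyticTerm
  split_ifs with h1 h2
  · simp
  · rw [zero_pow (by omega)]; simp
  · rw [zero_pow (by omega)]; simp

theorem fourier_eq_toCircle_zpow (k : ℤ) (x : UnitAddCircle) :
    fourier k x = (x.toCircle : ℂ) ^ k := by
  rw [fourier_apply, AddCircle.toCircle_zsmul, Circle.coe_zpow]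

theorem analyticTerm_toCircle (k : ℤ) (b : ℂ) (x : UnitAddCircle) :
    analyticTerm k b x.toCircle = if k = 0 then (b.re : ℂ) else if 0 < k then b * fourier k x
      else (starRingEnd ℂ) (b * fourier k x) := by
  unfold analyticTerm
  split_ifs with h1 h2
  · rfl
  · rw [fourier_eq_toCircle_zpow]
    congr 1
    rw [← zpow_natCast, Int.toNat_of_nonneg h2.le]
  · rw [map_mul, ← fourier_neg, fourier_eq_toCircle_zpow]
    congr 1
    rw [← zpow_natCast, Int.toNat_of_nonneg (by omega)]

theorem analyticTerm_re (k : ℤ) (b : ℂ) (x : UnitAddCircle) :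
    (analyticTerm k b x.toCircle).re = (b * fourier k x).re := by
  rw [analyticTerm_toCircle]
  split_ifs with h1 h2
  · subst h1; simp
  · rfl
  · rw [Complex.conj_re]

/-- The map `b ↦ analyticTerm k b` is only real-linear. The combination with `I * b` doubles its
complex-linear part and cancels the conjugate-linear one, so only nonnegative frequencies survive.
At frequency zero the outcome is `b` rather than `2 b`, whence the correction. -/
theorem analyticTerm_sub_I_mul (k : ℤ) (b : ℂ) (x : UnitAddCircle) :
    analyticTerm k b x.toCircle - Complex.I * analyticTerm k (Complex.I * b) x.toCircle =
      2 * (if 0 ≤ k then b * fourier k x else 0) - if k = 0 then b else 0 := by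
  rw [analyticTerm_toCircle, analyticTerm_toCircle]
  rcases lt_trichotomy k 0 with h | h | h
  · simp only [h.ne, h.not_gt, h.not_ge, if_false, map_mul, Complex.conj_I]
    linear_combination (starRingEnd ℂ b) * (starRingEnd ℂ (fourier k x)) * Complex.I_mul_I
  · subst h
    simp only [if_true, le_refl, fourier_zero]
    apply Complex.ext <;> simp <;> ring
  · simp only [h.ne', h, h.le, if_true, if_false]
    linear_combination (-b * (fourier k x)) * Complex.I_mul_I

theorem exists_finset_sum_fourier_near {h : UnitAddCircle → ℂ} (hh : Continuous h) {δ : ℝ}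
    (hδ : 0 < δ) : ∃ (s : Finset ℤ) (c : ℤ → ℂ), ∀ x,
      ‖∑ k ∈ s, c k * fourier k x - h x‖ < δ := by
  have hmem : (⟨h, hh⟩ : C(UnitAddCircle, ℂ)) ∈
      closure (Submodule.span ℂ (Set.range (fourier (T := 1))) : Set C(UnitAddCircle, ℂ)) := by
    have := span_fourier_closure_eq_top (T := 1)
    rw [← Submodule.topologicalClosure_coe, this]
    trivial
  obtain ⟨u, hu, hd⟩ := Metric.mem_closure_iff.1 hmem δ hδ
  obtain ⟨c, rfl⟩ := Finsupp.mem_span_range_iff_exists_finsupp.1 hu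
  refine ⟨c.support, c, fun x => ?_⟩
  rw [dist_comm, dist_eq_norm] at hd
  refine lt_of_le_of_lt (le_trans (le_of_eq ?_)
    (ContinuousMap.norm_coe_le_norm _ x)) hd
  simp [Finsupp.sum, ContinuousMap.sum_apply]

/-- Boundedness of the map taking a trigonometric polynomial to the holomorphic polynomial with the
same real part on the circle. -/
theorem exists_integral_norm_analytic_le {q : ℝ} (h1 : 1 < q) (h2 : q < 2) :
    ∃ K : ℝ, 0 ≤ K ∧ ∀ {ι : Type} (s : Finset ι) (κ : ι → ℤ) (b : ι → ℂ),
      ∫ x : UnitAddCircle, ‖∑ i ∈ s, analyticTerm (κ i) (b i) x.toCircle‖ ^ q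
          ∂AddCircle.haarAddCircle ≤
        K * ∫ x : UnitAddCircle, ‖∑ i ∈ s, b i * fourier (κ i) x‖ ^ q
          ∂AddCircle.haarAddCircle := by
  obtain ⟨A, B, hA, hB, hAB⟩ := exists_norm_rpow_le_re_rpow_sub h1 h2
  have hq0 : (0 : ℝ) ≤ q := by linarith
  refine ⟨2 ^ q * (2 * A) * 2 ^ q, by positivity, fun {ι} s κ b => ?_⟩
  set g : UnitAddCircle → ℂ := fun x => ∑ i ∈ s, b i * fourier (κ i) x with hg
  have hgc : Continuous g := by rw [hg]; fun_prop
  set G : ℂ → ℂ := fun z => ∑ i ∈ s, analyticTerm (κ i) (b i) z with hG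
  have hGd : Differentiable ℂ G := Differentiable.fun_sum fun i _ => differentiable_analyticTerm _ _
  have hG0 : (G 0).im = 0 := by
    rw [hG, Complex.im_sum]
    exact Finset.sum_eq_zero fun i _ => analyticTerm_zero_im _ _
  have hGre : ∀ x : UnitAddCircle, (G x.toCircle).re = (g x).re := fun x => by
    simp only [hG, hg, Complex.re_sum, analyticTerm_re]
  have hgq : Continuous fun x => ‖g x‖ ^ q := hgc.norm.rpow_const fun _ => Or.inr hq0
  have main : ∀ δ : ℝ, 0 < δ →
      ∫ x : UnitAddCircle, ‖G x.toCircle‖ ^ q ∂AddCircle.haarAddCircle ≤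
        2 ^ q * (2 * A) * 2 ^ q *
          (∫ x : UnitAddCircle, ‖g x‖ ^ q ∂AddCircle.haarAddCircle + (3 * δ) ^ q) := by
    intro δ hδ
    -- The positive part of `Re g` is not the real part of a polynomial, so it is raised by `2 δ`
    -- and approximated within `δ` by a trigonometric polynomial. The margin left keeps the real
    -- part of `U` between `δ` and `‖g‖ + 3 δ`.
    have hhc : Continuous fun x => ((max (g x).re 0 + 2 * δ : ℝ) : ℂ) := by
      have := Complex.continuous_re.comp hgc
      exact Complex.continuous_ofReal.comp ((this.max continuous_const).add continuous_const)
    obtain ⟨t, c, hc⟩ := exists_finset_sum_fourier_near hhc hδ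
    set U : ℂ → ℂ := fun z => ∑ k ∈ t, analyticTerm k (c k) z with hU
    have hUd : Differentiable ℂ U :=
      Differentiable.fun_sum fun i _ => differentiable_analyticTerm _ _
    have hU0 : (U 0).im = 0 := by
      rw [hU, Complex.im_sum]
      exact Finset.sum_eq_zero fun i _ => analyticTerm_zero_im _ _
    have hUre : ∀ x : UnitAddCircle, |(U x.toCircle).re - (max (g x).re 0 + 2 * δ)| < δ := by
      intro x
      have h3 := (Complex.abs_re_le_norm _).trans_lt (hc x)
      rw [Complex.sub_re, Complex.ofReal_re, Complex.re_sum] at h3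
      simpa only [hU, Complex.re_sum, analyticTerm_re] using h3
    have hbound : ∀ {F : ℂ → ℂ}, Differentiable ℂ F → (F 0).im = 0 →
        (∀ x : UnitAddCircle, δ ≤ (F x.toCircle).re ∧ (F x.toCircle).re ≤ ‖g x‖ + 3 * δ) →
        ∫ x : UnitAddCircle, ‖F x.toCircle‖ ^ q ∂AddCircle.haarAddCircle ≤
          A * ∫ x : UnitAddCircle, (‖g x‖ + 3 * δ) ^ q ∂AddCircle.haarAddCircle := by
      intro F hF hF0 hFre
      refine (integral_norm_rpow_le_integral_re_rpow hB h1 hAB hF hδ (fun x => (hFre x).1)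
        hF0).trans (mul_le_mul_of_nonneg_left ?_ hA)
      have hcF : Continuous fun x : UnitAddCircle => (F x.toCircle).re :=
        Complex.continuous_re.comp (hF.continuous.comp continuous_toCircle_coe)
      refine integral_mono (integrable_of_continuous_circle
        (hcF.rpow_const fun _ => Or.inr hq0)) (integrable_of_continuous_circle
        ((hgc.norm.add continuous_const).rpow_const fun _ => Or.inr hq0)) fun x => ?_
      exact Real.rpow_le_rpow (hδ.le.trans (hFre x).1) (hFre x).2 hq0
    have hb1 := hbound hUd hU0 fun x => by
      have := abs_lt.1 (hUre x)
      have h3 := le_max_right (g x).re 0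
      have h4 : max (g x).re 0 ≤ ‖g x‖ := max_le (Complex.re_le_norm _) (norm_nonneg _)
      constructor <;> linarith
    -- The real part of `U - G` is within `δ` of the negative part of `Re g` plus `2 δ`. Hence `G =
    -- U - (U - G)` is a difference of two functions to which the positive case applies.
    have hb2 := hbound (hUd.sub hGd) (by simp [hU0, hG0]) fun x => by
      have := abs_lt.1 (hUre x)
      have h3 := le_max_left (g x).re 0
      have h4 : max (g x).re 0 - (g x).re ≤ ‖g x‖ := by
        rcases max_choice (g x).re 0 with h | h <;> rw [h]
        · simp
        · linarith [neg_le_of_abs_le (Complex.abs_re_le_norm (g x))]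
      rw [Pi.sub_apply, Complex.sub_re, hGre]
      constructor <;> linarith
    have hcU : Continuous fun x : UnitAddCircle => U x.toCircle :=
      hUd.continuous.comp continuous_toCircle_coe
    have hcG : Continuous fun x : UnitAddCircle => G x.toCircle :=
      hGd.continuous.comp continuous_toCircle_coe
    have hi1 : Integrable (fun x : UnitAddCircle => ‖U x.toCircle‖ ^ q) AddCircle.haarAddCircle :=
      integrable_of_continuous_circle (hcU.norm.rpow_const fun _ => Or.inr hq0)
    have hi2 : Integrable (fun x : UnitAddCircle => ‖(U - G) x.toCircle‖ ^ q)
        AddCircle.haarAddCircle :=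
      integrable_of_continuous_circle ((hcU.sub hcG).norm.rpow_const fun _ => Or.inr hq0)
    have hi3 : Integrable (fun x : UnitAddCircle => ‖g x‖ ^ q) AddCircle.haarAddCircle :=
      integrable_of_continuous_circle hgq
    calc ∫ x : UnitAddCircle, ‖G x.toCircle‖ ^ q ∂AddCircle.haarAddCircle
        ≤ ∫ x : UnitAddCircle, 2 ^ q * (‖U x.toCircle‖ ^ q + ‖(U - G) x.toCircle‖ ^ q)
            ∂AddCircle.haarAddCircle := by
          refine integral_mono (integrable_of_continuous_circle
            (hcG.norm.rpow_const fun _ => Or.inr hq0)) ((hi1.add hi2).const_mul _) fun x => ?_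
          refine le_trans ?_ (Real.add_rpow_le_two_rpow_mul (norm_nonneg _) (norm_nonneg _) hq0)
          refine Real.rpow_le_rpow (norm_nonneg _) ?_ hq0
          have := norm_sub_le (U x.toCircle) ((U - G) x.toCircle)
          simpa using this
      _ ≤ 2 ^ q * ((2 * A) *
            ∫ x : UnitAddCircle, (‖g x‖ + 3 * δ) ^ q ∂AddCircle.haarAddCircle) := by
          rw [integral_const_mul, integral_add hi1 hi2]
          gcongr
          linarith
      _ ≤ 2 ^ q * ((2 * A) * (2 ^ q *
            (∫ x : UnitAddCircle, ‖g x‖ ^ q ∂AddCircle.haarAddCircle + (3 * δ) ^ q))) := by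
          gcongr
          calc _ ≤ ∫ x : UnitAddCircle, 2 ^ q * (‖g x‖ ^ q + (3 * δ) ^ q)
                ∂AddCircle.haarAddCircle := by
                refine integral_mono (integrable_of_continuous_circle
                  ((hgc.norm.add continuous_const).rpow_const fun _ => Or.inr hq0))
                  ((hi3.add (integrable_const _)).const_mul _) fun x => ?_
                exact Real.add_rpow_le_two_rpow_mul (norm_nonneg _) (by positivity) hq0
            _ = _ := by
                rw [integral_const_mul, integral_add hi3 (integrable_const _), integral_const]
                simp
      _ = _ := by ring
  have hlim : Tendsto (fun δ : ℝ => 2 ^ q * (2 * A) * 2 ^ q *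
      (∫ x : UnitAddCircle, ‖g x‖ ^ q ∂AddCircle.haarAddCircle + (3 * δ) ^ q)) (𝓝[>] 0)
      (𝓝 (2 ^ q * (2 * A) * 2 ^ q *
        (∫ x : UnitAddCircle, ‖g x‖ ^ q ∂AddCircle.haarAddCircle + (3 * 0) ^ q))) := by
    refine tendsto_nhdsWithin_of_tendsto_nhds (Continuous.tendsto ?_ 0)
    have : Continuous fun δ : ℝ => (3 * δ) ^ q :=
      (continuous_const.mul continuous_id).rpow_const fun _ => Or.inr hq0
    fun_prop
  rw [mul_zero, Real.zero_rpow (by linarith), add_zero] at hlim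
  exact ge_of_tendsto hlim (eventually_mem_nhdsWithin.mono fun δ hδ => main δ hδ)

theorem integral_fourier_circle (k : ℤ) :
    ∫ x : UnitAddCircle, fourier k x ∂AddCircle.haarAddCircle = if k = 0 then 1 else 0 := by
  split_ifs with h
  · subst h; simp
  · exact integral_eq_zero_of_add_right_eq_neg (μ := AddCircle.haarAddCircle)
      (fourier_add_half_inv_index h one_pos)

/-- The zeroth Fourier coefficient is the mean over the circle, so this is Jensen's inequality. It
controls the correction term in `analyticTerm_sub_I_mul`. -/
theorem norm_sum_zero_freq_rpow_le {q : ℝ} (hq : 1 ≤ q) {ι : Type} (s : Finset ι) (κ : ι → ℤ)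
    (b : ι → ℂ) :
    ‖∑ i ∈ s, if κ i = 0 then b i else 0‖ ^ q ≤
      ∫ x : UnitAddCircle, ‖∑ i ∈ s, b i * fourier (κ i) x‖ ^ q ∂AddCircle.haarAddCircle := by
  have hgc : Continuous fun x : UnitAddCircle => ∑ i ∈ s, b i * fourier (κ i) x := by fun_prop
  have h0 : ∑ i ∈ s, (if κ i = 0 then b i else 0) =
      ∫ x : UnitAddCircle, ∑ i ∈ s, b i * fourier (κ i) x ∂AddCircle.haarAddCircle := by
    rw [integral_finsetSum _ fun i _ => integrable_of_continuous_circle (by fun_prop)]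
    refine Finset.sum_congr rfl fun i _ => ?_
    rw [integral_const_mul, integral_fourier_circle, mul_ite, mul_one, mul_zero]
  rw [h0]
  refine (Real.rpow_le_rpow (norm_nonneg _) (norm_integral_le_integral_norm _)
    (by linarith)).trans ?_
  exact (convexOn_rpow hq).map_integral_le
    (continuousOn_id.rpow_const fun _ _ => Or.inr (by linarith)) isClosed_Ici
    (ae_of_all _ fun x => norm_nonneg _) (integrable_of_continuous_circle hgc.norm)
    (integrable_of_continuous_circle (hgc.norm.rpow_const fun _ => Or.inr (by linarith)))

/-- The Riesz projection is bounded in `L^q` of the circle. -/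
theorem exists_integral_nonneg_freq_le {q : ℝ} (h1 : 1 < q) (h2 : q < 2) :
    ∃ K : ℝ, 0 ≤ K ∧ ∀ {ι : Type} (s : Finset ι) (κ : ι → ℤ) (b : ι → ℂ),
      ∫ x : UnitAddCircle, ‖∑ i ∈ s with 0 ≤ κ i, b i * fourier (κ i) x‖ ^ q
          ∂AddCircle.haarAddCircle ≤
        K * ∫ x : UnitAddCircle, ‖∑ i ∈ s, b i * fourier (κ i) x‖ ^ q
          ∂AddCircle.haarAddCircle := by
  obtain ⟨K, hK, hA⟩ := exists_integral_norm_analytic_le h1 h2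
  have hq0 : (0 : ℝ) ≤ q := by linarith
  refine ⟨2 ^ q * (K + 2 ^ q * (K + 1)), by positivity, fun {ι} s κ b => ?_⟩
  set Y := ∫ x : UnitAddCircle, ‖∑ i ∈ s, b i * fourier (κ i) x‖ ^ q
          ∂AddCircle.haarAddCircle with hY
  set c₀ := ∑ i ∈ s, (if κ i = 0 then b i else 0) with hc₀
  have e1 := hA s κ b
  have e2 := hA s κ fun i => Complex.I * b i
  have e2' : ∫ x : UnitAddCircle, ‖∑ i ∈ s, Complex.I * b i * fourier (κ i) x‖ ^ q
          ∂AddCircle.haarAddCircle = Y := by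
    refine integral_congr_ae (ae_of_all _ fun x => ?_)
    simp only [mul_assoc]
    rw [← Finset.mul_sum, norm_mul, Complex.norm_I, one_mul]
  rw [e2'] at e2
  have e3 : ‖c₀‖ ^ q ≤ Y := norm_sum_zero_freq_rpow_le h1.le s κ b
  set F : UnitAddCircle → ℂ := fun x => ∑ i ∈ s, analyticTerm (κ i) (b i) x.toCircle with hF
  set F' : UnitAddCircle → ℂ :=
    fun x => ∑ i ∈ s, analyticTerm (κ i) (Complex.I * b i) x.toCircle with hF'
  have hFc : Continuous F := continuous_finsetSum _ fun i _ =>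
    (differentiable_analyticTerm _ _).continuous.comp continuous_toCircle_coe
  have hFc' : Continuous F' := continuous_finsetSum _ fun i _ =>
    (differentiable_analyticTerm _ _).continuous.comp continuous_toCircle_coe
  have hpt : ∀ x : UnitAddCircle, ‖∑ i ∈ s with 0 ≤ κ i, b i * fourier (κ i) x‖ ≤
      ‖F x‖ + (‖F' x‖ + ‖c₀‖) := by
    intro x
    have : 2 * ∑ i ∈ s with 0 ≤ κ i, b i * fourier (κ i) x = F x - Complex.I * F' x + c₀ := by
      rw [Finset.sum_filter, hF, hF', hc₀, Finset.mul_sum, Finset.mul_sum,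
        ← Finset.sum_sub_distrib, ← Finset.sum_add_distrib]
      refine Finset.sum_congr rfl fun i _ => ?_
      rw [analyticTerm_sub_I_mul, sub_add_cancel]
    have h3 : 2 * ‖∑ i ∈ s with 0 ≤ κ i, b i * fourier (κ i) x‖ ≤ ‖F x‖ + (‖F' x‖ + ‖c₀‖) := by
      rw [← Complex.norm_two, ← norm_mul, this]
      refine (norm_add_le _ _).trans ?_
      have := norm_sub_le (F x) (Complex.I * F' x)
      rw [norm_mul, Complex.norm_I, one_mul] at this
      linarith
    linarith [norm_nonneg (∑ i ∈ s with 0 ≤ κ i, b i * fourier (κ i) x)]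
  have hpc : Continuous fun x : UnitAddCircle => ∑ i ∈ s with 0 ≤ κ i, b i * fourier (κ i) x := by
    fun_prop
  have hi1 : Integrable (fun x => ‖F x‖ ^ q) AddCircle.haarAddCircle :=
    integrable_of_continuous_circle (hFc.norm.rpow_const fun _ => Or.inr hq0)
  have hi2 : Integrable (fun x => ‖F' x‖ ^ q) AddCircle.haarAddCircle :=
    integrable_of_continuous_circle (hFc'.norm.rpow_const fun _ => Or.inr hq0)
  have hi3 : Integrable (fun x => 2 ^ q * (‖F' x‖ ^ q + ‖c₀‖ ^ q)) AddCircle.haarAddCircle :=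
    (hi2.add (integrable_const _)).const_mul _
  calc _ ≤ ∫ x : UnitAddCircle, 2 ^ q * (‖F x‖ ^ q + 2 ^ q * (‖F' x‖ ^ q + ‖c₀‖ ^ q))
        ∂AddCircle.haarAddCircle := by
        refine integral_mono (integrable_of_continuous_circle
          (hpc.norm.rpow_const fun _ => Or.inr hq0)) ((hi1.add hi3).const_mul _) fun x => ?_
        refine (Real.rpow_le_rpow (norm_nonneg _) (hpt x) hq0).trans ?_
        refine (Real.add_rpow_le_two_rpow_mul (by positivity) (by positivity) hq0).trans ?_
        gcongr
        exact Real.add_rpow_le_two_rpow_mul (by positivity) (by positivity) hq0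
    _ = 2 ^ q * (∫ x, ‖F x‖ ^ q ∂AddCircle.haarAddCircle +
          2 ^ q * (∫ x, ‖F' x‖ ^ q ∂AddCircle.haarAddCircle + ‖c₀‖ ^ q)) := by
        rw [integral_const_mul, integral_add hi1 hi3, integral_const_mul,
          integral_add hi2 (integrable_const _), integral_const]
        simp
    _ ≤ 2 ^ q * (K * Y + 2 ^ q * (K * Y + Y)) := by gcongr
    _ = _ := by ring

/-- Multiplication by a character shifts the frequencies without changing the modulus, so every
cut-off `m` has the constant of the cut-off `0`. -/
theorem exists_integral_freq_ge_le {q : ℝ} (h1 : 1 < q) (h2 : q < 2) :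
    ∃ K : ℝ, 0 ≤ K ∧ ∀ {ι : Type} (s : Finset ι) (κ : ι → ℤ) (b : ι → ℂ) (m : ℤ),
      ∫ x : UnitAddCircle, ‖∑ i ∈ s with m ≤ κ i, b i * fourier (κ i) x‖ ^ q
          ∂AddCircle.haarAddCircle ≤
        K * ∫ x : UnitAddCircle, ‖∑ i ∈ s, b i * fourier (κ i) x‖ ^ q
          ∂AddCircle.haarAddCircle := by
  obtain ⟨K, hK, hP⟩ := exists_integral_nonneg_freq_le h1 h2
  refine ⟨K, hK, fun {ι} s κ b m => ?_⟩
  have hshift : ∀ (t : Finset ι) (x : UnitAddCircle),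
      ‖∑ i ∈ t, b i * fourier (κ i - m) x‖ = ‖∑ i ∈ t, b i * fourier (κ i) x‖ := by
    intro t x
    have : ∑ i ∈ t, b i * fourier (κ i) x = fourier m x * ∑ i ∈ t, b i * fourier (κ i - m) x := by
      rw [Finset.mul_sum]
      refine Finset.sum_congr rfl fun i _ => ?_
      rw [show fourier (κ i) x = fourier (m + (κ i - m)) x by rw [add_sub_cancel], fourier_add]
      ring
    rw [this, norm_mul, fourier_apply, Circle.norm_coe, one_mul]
  have := hP s (fun i => κ i - m) b
  simpa only [sub_nonneg, hshift] using this

/-- Symmetric partial sums of trigonometric polynomials are uniformly bounded in `L^q` of the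
circle. -/
theorem exists_lintegral_abs_freq_le {q : ℝ} (h1 : 1 < q) (h2 : q < 2) :
    ∃ C : ℝ≥0, ∀ {ι : Type} (s : Finset ι) (κ : ι → ℤ) (b : ι → ℂ) (N : ℕ),
      ∫⁻ x : UnitAddCircle, ‖∑ i ∈ s with |κ i| ≤ (N : ℤ), b i * fourier (κ i) x‖ₑ ^ q
          ∂AddCircle.haarAddCircle ≤
        C * ∫⁻ x : UnitAddCircle, ‖∑ i ∈ s, b i * fourier (κ i) x‖ₑ ^ q
          ∂AddCircle.haarAddCircle := by
  obtain ⟨K, hK, hP⟩ := exists_integral_freq_ge_le h1 h2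
  have hq0 : (0 : ℝ) ≤ q := by linarith
  refine ⟨(2 ^ q * (2 * K)).toNNReal, fun {ι} s κ b N => ?_⟩
  have hconv : ∀ t : Finset ι, ∫⁻ x : UnitAddCircle, ‖∑ i ∈ t, b i * fourier (κ i) x‖ₑ ^ q
      ∂AddCircle.haarAddCircle = ENNReal.ofReal (∫ x : UnitAddCircle,
        ‖∑ i ∈ t, b i * fourier (κ i) x‖ ^ q ∂AddCircle.haarAddCircle) := by
    intro t
    have hc : Continuous fun x : UnitAddCircle => ∑ i ∈ t, b i * fourier (κ i) x := by fun_prop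
    rw [ofReal_integral_eq_lintegral_ofReal (integrable_of_continuous_circle
      (hc.norm.rpow_const fun _ => Or.inr hq0)) (ae_of_all _ fun x => by positivity)]
    refine lintegral_congr fun x => ?_
    rw [← ENNReal.ofReal_rpow_of_nonneg (norm_nonneg _) hq0, ofReal_norm]
  rw [hconv, hconv, ← ENNReal.ofReal_coe_nnreal, Real.coe_toNNReal _ (by positivity),
    ← ENNReal.ofReal_mul (by positivity)]
  refine ENNReal.ofReal_le_ofReal ?_
  have hi : ∀ t : Finset ι, Integrable
      (fun x : UnitAddCircle => ‖∑ i ∈ t, b i * fourier (κ i) x‖ ^ q)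
      AddCircle.haarAddCircle := fun t => by
    have hc : Continuous fun x : UnitAddCircle => ∑ i ∈ t, b i * fourier (κ i) x := by fun_prop
    exact integrable_of_continuous_circle (hc.norm.rpow_const fun _ => Or.inr hq0)
  -- The window `|κ| ≤ N` is the half-line `κ ≥ -N` with the half-line `κ ≥ N + 1` removed.
  have hpt : ∀ x : UnitAddCircle, ‖∑ i ∈ s with |κ i| ≤ (N : ℤ), b i * fourier (κ i) x‖ ≤
      ‖∑ i ∈ s with -(N : ℤ) ≤ κ i, b i * fourier (κ i) x‖ +
        ‖∑ i ∈ s with (N : ℤ) + 1 ≤ κ i, b i * fourier (κ i) x‖ := by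
    intro x
    refine le_trans (le_of_eq ?_) (norm_sub_le _ _)
    congr 1
    rw [Finset.sum_filter, Finset.sum_filter, Finset.sum_filter, ← Finset.sum_sub_distrib]
    refine Finset.sum_congr rfl fun i _ => ?_
    simp only [abs_le]
    split_ifs <;> first | omega | simp
  calc _ ≤ ∫ x : UnitAddCircle, 2 ^ q *
        (‖∑ i ∈ s with -(N : ℤ) ≤ κ i, b i * fourier (κ i) x‖ ^ q +
        ‖∑ i ∈ s with (N : ℤ) + 1 ≤ κ i, b i * fourier (κ i) x‖ ^ q)
          ∂AddCircle.haarAddCircle := by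
        refine integral_mono (hi _) (((hi _).add (hi _)).const_mul _) fun x => ?_
        exact (Real.rpow_le_rpow (norm_nonneg _) (hpt x) hq0).trans
          (Real.add_rpow_le_two_rpow_mul (norm_nonneg _) (norm_nonneg _) hq0)
    _ ≤ _ := by
        rw [integral_const_mul, integral_add (hi _) (hi _), mul_assoc]
        gcongr
        linarith [hP s κ b (-(N : ℤ)), hP s κ b ((N : ℤ) + 1)]

/-! ### Square partial sums on the torus -/

/-- The normalised Haar measure of the torus. -/
noncomputable abbrev torusMeasure (n : ℕ) : Measure (UnitAddTorus (Fin n)) :=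
  Measure.pi fun _ => AddCircle.haarAddCircle

theorem fourier_apply_add (k : ℤ) (x y : UnitAddCircle) :
    fourier k (x + y) = fourier k x * fourier k y := by
  simp only [fourier_eq_toCircle_zpow, AddCircle.toCircle_add, Circle.coe_mul, mul_zpow]

theorem mFourier_apply_add {n : ℕ} (α : Fin n → ℤ) (θ φ : UnitAddTorus (Fin n)) :
    UnitAddTorus.mFourier α (θ + φ) = UnitAddTorus.mFourier α θ * UnitAddTorus.mFourier α φ := by
  simp only [UnitAddTorus.mFourier, ContinuousMap.coe_mk, Pi.add_apply, fourier_apply_add,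
    Finset.prod_mul_distrib]

theorem mFourier_apply_single {n : ℕ} (α : Fin n → ℤ) (j : Fin n) (x : UnitAddCircle) :
    UnitAddTorus.mFourier α (Pi.single j x) = fourier (α j) x := by
  simp only [UnitAddTorus.mFourier, ContinuousMap.coe_mk]
  rw [Finset.prod_eq_single j]
  · simp
  · intro i _ hi
    rw [Pi.single_eq_of_ne hi, fourier_eval_zero]
  · simp

theorem norm_mFourier_apply {n : ℕ} (α : Fin n → ℤ) (θ : UnitAddTorus (Fin n)) :
    ‖UnitAddTorus.mFourier α θ‖ = 1 := by
  simp only [UnitAddTorus.mFourier, ContinuousMap.coe_mk, norm_prod, fourier_apply,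
    Circle.norm_coe, Finset.prod_const_one]

/-- Tonelli and translation invariance of Haar measure. The inner integral isolates one coordinate,
with `θ` frozen, so that inequalities on the circle can be used there. -/
theorem lintegral_torus_eq_lintegral_single {n : ℕ} (j : Fin n) {h : UnitAddTorus (Fin n) → ℝ≥0∞}
    (hh : Measurable h) :
    ∫⁻ θ, h θ ∂torusMeasure n =
      ∫⁻ θ, ∫⁻ x, h (θ + Pi.single j x) ∂AddCircle.haarAddCircle ∂torusMeasure n := by
  rw [lintegral_lintegral_swap]
  · simp only [lintegral_add_right_eq_self (μ := torusMeasure n) h]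
    simp
  · refine (hh.comp ?_).aemeasurable
    have : Continuous fun p : UnitAddTorus (Fin n) × UnitAddCircle =>
        p.1 + (Pi.single j p.2 : UnitAddTorus (Fin n)) :=
      continuous_fst.add ((continuous_single j).comp continuous_snd)
    exact this.measurable

/-- Moving only the coordinate `j` turns the sum into a trigonometric polynomial on the circle with
frequencies `α j`. Distinct `α` can share the same `α j`; this is why the circle inequalities are
stated for an arbitrary finite family of frequencies with possible repetitions. -/
theorem lintegral_torus_abs_freq_le {q : ℝ} {C : ℝ≥0}
    (hC : ∀ {ι : Type} (s : Finset ι) (κ : ι → ℤ) (b : ι → ℂ) (N : ℕ),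
      ∫⁻ x : UnitAddCircle, ‖∑ i ∈ s with |κ i| ≤ (N : ℤ), b i * fourier (κ i) x‖ₑ ^ q
          ∂AddCircle.haarAddCircle ≤
        C * ∫⁻ x : UnitAddCircle, ‖∑ i ∈ s, b i * fourier (κ i) x‖ₑ ^ q
          ∂AddCircle.haarAddCircle)
    {n : ℕ} (j : Fin n) (s : Finset (Fin n → ℤ)) (c : (Fin n → ℤ) → ℂ) (N : ℕ) :
    ∫⁻ θ, ‖∑ α ∈ s with |α j| ≤ (N : ℤ), c α * UnitAddTorus.mFourier α θ‖ₑ ^ q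
        ∂torusMeasure n ≤
      C * ∫⁻ θ, ‖∑ α ∈ s, c α * UnitAddTorus.mFourier α θ‖ₑ ^ q ∂torusMeasure n := by
  have hm : ∀ t : Finset (Fin n → ℤ),
      Measurable fun θ => ‖∑ α ∈ t, c α * UnitAddTorus.mFourier α θ‖ₑ ^ q := fun t => by
    have : Continuous fun θ => ∑ α ∈ t, c α * UnitAddTorus.mFourier α θ := by fun_prop
    exact this.measurable.enorm.pow_const q
  rw [lintegral_torus_eq_lintegral_single j (hm _), lintegral_torus_eq_lintegral_single j (hm _),
    ← lintegral_const_mul' _ _ ENNReal.coe_ne_top]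
  refine lintegral_mono fun θ => ?_
  have := hC s (fun α => α j) (fun α => c α * UnitAddTorus.mFourier α θ) N
  simpa only [mFourier_apply_add, mFourier_apply_single, mul_assoc] using this

/-- Square partial sums of trigonometric polynomials are uniformly bounded in `L^q` of the torus. -/
theorem exists_lintegral_torus_square_le {q : ℝ} (h1 : 1 < q) (h2 : q < 2) (n : ℕ) :
    ∃ C : ℝ≥0, ∀ (s : Finset (Fin n → ℤ)) (c : (Fin n → ℤ) → ℂ) (N : ℕ),
      ∫⁻ θ, ‖∑ α ∈ s with ∀ j, |α j| ≤ (N : ℤ), c α * UnitAddTorus.mFourier α θ‖ₑ ^ q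
          ∂torusMeasure n ≤
        C * ∫⁻ θ, ‖∑ α ∈ s, c α * UnitAddTorus.mFourier α θ‖ₑ ^ q ∂torusMeasure n := by
  obtain ⟨C, hC⟩ := exists_lintegral_abs_freq_le h1 h2
  -- The coordinates are truncated one after another, each at the cost of a factor `C`.
  have key : ∀ J : Finset (Fin n), ∀ (s : Finset (Fin n → ℤ)) (c : (Fin n → ℤ) → ℂ) (N : ℕ),
      ∫⁻ θ, ‖∑ α ∈ s with ∀ j ∈ J, |α j| ≤ (N : ℤ), c α * UnitAddTorus.mFourier α θ‖ₑ ^ q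
          ∂torusMeasure n ≤
        (C : ℝ≥0∞) ^ J.card *
          ∫⁻ θ, ‖∑ α ∈ s, c α * UnitAddTorus.mFourier α θ‖ₑ ^ q ∂torusMeasure n := by
    intro J
    induction J using Finset.induction_on with
    | empty => intro s c N; simp
    | insert j J hj ih =>
      intro s c N
      have hs : (s.filter fun α => ∀ i ∈ insert j J, |α i| ≤ (N : ℤ)) =
          (s.filter fun α => ∀ i ∈ J, |α i| ≤ (N : ℤ)).filter fun α => |α j| ≤ (N : ℤ) := by
        ext α
        simp only [Finset.mem_filter, Finset.forall_mem_insert]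
        tauto
      rw [hs, Finset.card_insert_of_notMem hj, pow_succ', mul_assoc]
      exact (lintegral_torus_abs_freq_le hC j _ c N).trans (mul_le_mul_right (ih s c N) _)
  refine ⟨C ^ n, fun s c N => ?_⟩
  simpa using key Finset.univ s c N

/-- The multi-indices with `|α|_∞ ≤ N`. -/
noncomputable abbrev squareBox (n N : ℕ) : Finset (Fin n → ℤ) :=
  Fintype.piFinset fun _ : Fin n => Finset.Icc (-(N : ℤ)) (N : ℤ)

theorem mem_squareBox {n N : ℕ} {α : Fin n → ℤ} : α ∈ squareBox n N ↔ ∀ j, |α j| ≤ (N : ℤ) := by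
  simp [squareBox, Fintype.mem_piFinset, abs_le]

theorem tendsto_squareBox_atTop (n : ℕ) : Tendsto (squareBox n) atTop atTop := by
  refine tendsto_atTop_finset_of_monotone (fun N M h α hα => ?_) fun α => ?_
  · rw [mem_squareBox] at hα ⊢
    exact fun j => (hα j).trans (by exact_mod_cast h)
  · refine ⟨∑ j, (α j).natAbs, mem_squareBox.2 fun j => ?_⟩
    rw [Int.abs_eq_natAbs]
    exact_mod_cast Finset.single_le_sum (f := fun j => (α j).natAbs) (fun _ _ => Nat.zero_le _)
      (Finset.mem_univ j)

/-! ### Passage from trigonometric polynomials to absolutely convergent Fourier series -/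

section AbsolutelySummable

variable {n : ℕ} {c : (Fin n → ℤ) → ℂ} {g : UnitAddTorus (Fin n) → ℂ}

theorem norm_sum_mul_mFourier_le (hc : Summable fun α => ‖c α‖) (s : Finset (Fin n → ℤ))
    (θ : UnitAddTorus (Fin n)) :
    ‖∑ α ∈ s, c α * UnitAddTorus.mFourier α θ‖ ≤ ∑' α, ‖c α‖ := by
  refine (norm_sum_le _ _).trans ?_
  simp only [norm_mul, norm_mFourier_apply, mul_one]
  exact hc.sum_le_tsum s fun _ _ => norm_nonneg _

theorem continuous_sum_mul_mFourier (s : Finset (Fin n → ℤ)) :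
    Continuous fun θ => ∑ α ∈ s, c α * UnitAddTorus.mFourier α θ := by fun_prop

/-- Dominated convergence: the partial sums and their limit are all bounded by `∑' α, ‖c α‖`, and
the torus has total mass one. -/
theorem tendsto_lintegral_squareBox_sub {q : ℝ} (hq : 0 < q) (hc : Summable fun α => ‖c α‖)
    (hg : Continuous g) (h : ∀ θ, HasSum (fun α => c α * UnitAddTorus.mFourier α θ) (g θ)) :
    Tendsto (fun N => ∫⁻ θ, ‖∑ α ∈ squareBox n N, c α * UnitAddTorus.mFourier α θ - g θ‖ₑ ^ q
      ∂torusMeasure n) atTop (𝓝 0) := by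
  set S := ∑' α, ‖c α‖
  have hgS : ∀ θ, ‖g θ‖ ≤ S := fun θ =>
    le_of_tendsto (h θ).norm (Eventually.of_forall fun s => norm_sum_mul_mFourier_le hc s θ)
  have h0 : ∫⁻ _ : UnitAddTorus (Fin n), 0 ∂torusMeasure n = 0 := lintegral_zero
  rw [← h0]
  refine tendsto_lintegral_of_dominated_convergence (fun _ => ENNReal.ofReal (S + S) ^ q)
    (fun N => ?_) (fun N => ae_of_all _ fun θ => ?_) ?_ (ae_of_all _ fun θ => ?_)
  · exact ((continuous_sum_mul_mFourier _).sub hg).measurable.enorm.pow_const q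
  · refine ENNReal.rpow_le_rpow ?_ hq.le
    rw [← ofReal_norm]
    exact ENNReal.ofReal_le_ofReal ((norm_sub_le _ _).trans
      (add_le_add (norm_sum_mul_mFourier_le hc _ θ) (hgS θ)))
  · simp only [lintegral_const, measure_univ, mul_one]
    exact ENNReal.rpow_ne_top_of_nonneg hq.le ENNReal.ofReal_ne_top
  · have h1 : Tendsto (fun N => ∑ α ∈ squareBox n N, c α * UnitAddTorus.mFourier α θ - g θ) atTop
        (𝓝 0) := by
      have := ((h θ).comp (tendsto_squareBox_atTop n)).sub_const (g θ)
      rwa [sub_self] at this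
    have h2 := (ENNReal.continuous_rpow_const (y := q)).tendsto 0 |>.comp
      ((continuous_enorm.tendsto (0 : ℂ)).comp h1 |>.trans (by rw [enorm_zero]))
    rw [ENNReal.zero_rpow_of_pos hq] at h2
    exact h2

/-- For `M ≥ N` the box of size `N` is a truncation of the polynomial summed over the box of size
`M`. The uniform bound applies to that polynomial, and then `M → ∞`. -/
theorem lintegral_squareBox_le {q : ℝ} (hq : 0 < q) {C : ℝ≥0}
    (hC : ∀ (s : Finset (Fin n → ℤ)) (c : (Fin n → ℤ) → ℂ) (N : ℕ),
      ∫⁻ θ, ‖∑ α ∈ s with ∀ j, |α j| ≤ (N : ℤ), c α * UnitAddTorus.mFourier α θ‖ₑ ^ q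
          ∂torusMeasure n ≤
        C * ∫⁻ θ, ‖∑ α ∈ s, c α * UnitAddTorus.mFourier α θ‖ₑ ^ q ∂torusMeasure n)
    (hc : Summable fun α => ‖c α‖)
    (h : ∀ θ, HasSum (fun α => c α * UnitAddTorus.mFourier α θ) (g θ)) (N : ℕ) :
    ∫⁻ θ, ‖∑ α ∈ squareBox n N, c α * UnitAddTorus.mFourier α θ‖ₑ ^ q ∂torusMeasure n ≤
      C * ∫⁻ θ, ‖g θ‖ₑ ^ q ∂torusMeasure n := by
  have hlim : Tendsto (fun M => ∫⁻ θ, ‖∑ α ∈ squareBox n M, c α * UnitAddTorus.mFourier α θ‖ₑ ^ q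
      ∂torusMeasure n) atTop (𝓝 (∫⁻ θ, ‖g θ‖ₑ ^ q ∂torusMeasure n)) := by
    refine tendsto_lintegral_of_dominated_convergence
      (fun _ => ENNReal.ofReal (∑' α, ‖c α‖) ^ q)
      (fun M => ?_) (fun M => ae_of_all _ fun θ => ?_) ?_ (ae_of_all _ fun θ => ?_)
    · exact (continuous_sum_mul_mFourier _).measurable.enorm.pow_const q
    · refine ENNReal.rpow_le_rpow ?_ hq.le
      rw [← ofReal_norm]
      exact ENNReal.ofReal_le_ofReal (norm_sum_mul_mFourier_le hc _ θ)
    · simp only [lintegral_const, measure_univ, mul_one]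
      exact ENNReal.rpow_ne_top_of_nonneg hq.le ENNReal.ofReal_ne_top
    · exact (ENNReal.continuous_rpow_const (y := q)).tendsto _ |>.comp
        ((continuous_enorm.tendsto (g θ)).comp ((h θ).comp (tendsto_squareBox_atTop n)))
  refine ge_of_tendsto (ENNReal.Tendsto.const_mul hlim (Or.inr ENNReal.coe_ne_top)) ?_
  filter_upwards [eventually_ge_atTop N] with M hM
  have hfil : (squareBox n M).filter (fun α => ∀ j, |α j| ≤ (N : ℤ)) = squareBox n N := by
    ext α
    rw [Finset.mem_filter, mem_squareBox, mem_squareBox]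
    exact ⟨fun h => h.2, fun h => ⟨fun j => (h j).trans (by exact_mod_cast hM), h⟩⟩
  have := hC (squareBox n M) c N
  rwa [hfil] at this

/-- The bound does not depend on `N`. Taken on each orbit of the domain, it supplies the dominating
function in `tendsto_eLpNorm_squarePartialSum_sub`. -/
theorem lintegral_squareBox_sub_le {q : ℝ} (hq : 1 ≤ q) {C : ℝ≥0}
    (hC : ∀ (s : Finset (Fin n → ℤ)) (c : (Fin n → ℤ) → ℂ) (N : ℕ),
      ∫⁻ θ, ‖∑ α ∈ s with ∀ j, |α j| ≤ (N : ℤ), c α * UnitAddTorus.mFourier α θ‖ₑ ^ q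
          ∂torusMeasure n ≤
        C * ∫⁻ θ, ‖∑ α ∈ s, c α * UnitAddTorus.mFourier α θ‖ₑ ^ q ∂torusMeasure n)
    (hc : Summable fun α => ‖c α‖) (hg : Continuous g)
    (h : ∀ θ, HasSum (fun α => c α * UnitAddTorus.mFourier α θ) (g θ)) (N : ℕ) :
    ∫⁻ θ, ‖∑ α ∈ squareBox n N, c α * UnitAddTorus.mFourier α θ - g θ‖ₑ ^ q ∂torusMeasure n ≤
      2 ^ (q - 1) * (C + 1) * ∫⁻ θ, ‖g θ‖ₑ ^ q ∂torusMeasure n := by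
  have h2 : (2 : ℝ≥0∞) ^ (q - 1) ≠ ∞ :=
    ENNReal.rpow_ne_top_of_nonneg (by linarith) ENNReal.ofNat_ne_top
  calc _ ≤ ∫⁻ θ, 2 ^ (q - 1) * (‖∑ α ∈ squareBox n N, c α * UnitAddTorus.mFourier α θ‖ₑ ^ q
        + ‖g θ‖ₑ ^ q) ∂torusMeasure n :=
        lintegral_mono fun θ => (ENNReal.rpow_le_rpow enorm_sub_le (by linarith)).trans
          (ENNReal.rpow_add_le_mul_rpow_add_rpow _ _ hq)
    _ = 2 ^ (q - 1) * (∫⁻ θ, ‖∑ α ∈ squareBox n N, c α * UnitAddTorus.mFourier α θ‖ₑ ^ q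
          ∂torusMeasure n + ∫⁻ θ, ‖g θ‖ₑ ^ q ∂torusMeasure n) := by
        rw [lintegral_const_mul' _ _ h2, lintegral_add_right _ (hg.measurable.enorm.pow_const q)]
    _ ≤ 2 ^ (q - 1) * (C * ∫⁻ θ, ‖g θ‖ₑ ^ q ∂torusMeasure n +
          ∫⁻ θ, ‖g θ‖ₑ ^ q ∂torusMeasure n) := by
        gcongr
        exact lintegral_squareBox_le (by linarith) hC hc h N
    _ = _ := by ring

end AbsolutelySummable

/-! ### The torus action on `ℂⁿ` -/

/-- The rotation of `ℂⁿ` by an element of the torus. -/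
noncomputable def torusRotate {n : ℕ} (θ : UnitAddTorus (Fin n)) (z : Fin n → ℂ) : Fin n → ℂ :=
  fun j => ((θ j).toCircle : ℂ) * z j

section TorusRotate

variable {n : ℕ}

theorem torusRotate_add (θ φ : UnitAddTorus (Fin n)) (z : Fin n → ℂ) :
    torusRotate (θ + φ) z = torusRotate θ (torusRotate φ z) := by
  ext j
  simp [torusRotate, AddCircle.toCircle_add, mul_assoc]

theorem torusRotate_zero (z : Fin n → ℂ) : torusRotate 0 z = z := by
  ext j
  simp [torusRotate]

theorem continuous_torusRotate_uncurry :
    Continuous fun p : (Fin n → ℂ) × UnitAddTorus (Fin n) => torusRotate p.2 p.1 := by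
  refine continuous_pi fun j => ?_
  exact (continuous_toCircle_coe.comp ((continuous_apply j).comp continuous_snd)).mul
    ((continuous_apply j).comp continuous_fst)

theorem continuous_torusRotate (θ : UnitAddTorus (Fin n)) : Continuous (torusRotate θ) :=
  continuous_torusRotate_uncurry.comp (continuous_id.prodMk continuous_const)

theorem continuous_torusRotate_left (z : Fin n → ℂ) :
    Continuous fun θ : UnitAddTorus (Fin n) => torusRotate θ z :=
  continuous_torusRotate_uncurry.comp (continuous_const.prodMk continuous_id)

theorem measurableEmbedding_torusRotate (θ : UnitAddTorus (Fin n)) :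
    MeasurableEmbedding (torusRotate θ) :=
  let e : (Fin n → ℂ) ≃ₜ (Fin n → ℂ) :=
    { toFun := torusRotate θ
      invFun := torusRotate (-θ)
      left_inv := fun z => by rw [← torusRotate_add, neg_add_cancel, torusRotate_zero]
      right_inv := fun z => by rw [← torusRotate_add, add_neg_cancel, torusRotate_zero]
      continuous_toFun := continuous_torusRotate θ
      continuous_invFun := continuous_torusRotate (-θ) }
  e.measurableEmbedding

theorem measurePreserving_torusRotate (θ : UnitAddTorus (Fin n)) :
    MeasurePreserving (torusRotate θ) volume volume := by
  have h1 : ∀ j : Fin n, MeasurePreserving (fun w : ℂ => ((θ j).toCircle : ℂ) * w)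
      volume volume := fun j => (rotation (θ j).toCircle).measurePreserving
  exact volume_preserving_pi h1

theorem laurentMonomial_torusRotate (α : Fin n → ℤ) (θ : UnitAddTorus (Fin n)) (z : Fin n → ℂ) :
    laurentMonomial α (torusRotate θ z) = UnitAddTorus.mFourier α θ * laurentMonomial α z := by
  simp only [laurentMonomial, torusRotate, UnitAddTorus.mFourier, ContinuousMap.coe_mk,
    fourier_eq_toCircle_zpow, mul_zpow, Finset.prod_mul_distrib]

variable {R : Set (Fin n → ℂ)}

theorem IsBoundedReinhardtDomain.torusRotate_mem (hR : IsBoundedReinhardtDomain R)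
    (θ : UnitAddTorus (Fin n)) {z : Fin n → ℂ} (hz : z ∈ R) : torusRotate θ z ∈ R := by
  choose t ht using fun j => QuotientAddGroup.mk_surjective (θ j)
  convert hR.rotate_mem z hz (fun j => 2 * Real.pi * t j) using 1
  ext j
  have : θ j = ((t j : ℝ) : UnitAddCircle) := (ht j).symm
  simp [torusRotate, this, AddCircle.toCircle_apply_mk, Circle.coe_exp]

theorem IsBoundedReinhardtDomain.preimage_torusRotate (hR : IsBoundedReinhardtDomain R)
    (θ : UnitAddTorus (Fin n)) : torusRotate θ ⁻¹' R = R := by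
  ext z
  refine ⟨fun h => ?_, fun h => hR.torusRotate_mem θ h⟩
  have := hR.torusRotate_mem (-θ) h
  rwa [← torusRotate_add, neg_add_cancel, torusRotate_zero] at this

theorem IsBoundedReinhardtDomain.setLIntegral_torusRotate (hR : IsBoundedReinhardtDomain R)
    (θ : UnitAddTorus (Fin n)) (φ : (Fin n → ℂ) → ℝ≥0∞) :
    ∫⁻ z in R, φ (torusRotate θ z) = ∫⁻ z in R, φ z := by
  have := (measurePreserving_torusRotate θ).setLIntegral_comp_preimage_emb
    (measurableEmbedding_torusRotate θ) φ R
  rwa [hR.preimage_torusRotate] at this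

theorem IsBoundedReinhardtDomain.setIntegral_torusRotate (hR : IsBoundedReinhardtDomain R)
    (θ : UnitAddTorus (Fin n)) (φ : (Fin n → ℂ) → ℂ) :
    ∫ z in R, φ (torusRotate θ z) = ∫ z in R, φ z := by
  have := (measurePreserving_torusRotate θ).setIntegral_preimage_emb
    (measurableEmbedding_torusRotate θ) φ R
  rwa [hR.preimage_torusRotate] at this

theorem IsBoundedReinhardtDomain.continuousOn_torusRotate (hR : IsBoundedReinhardtDomain R)
    {X : Type*} [TopologicalSpace X] {φ : (Fin n → ℂ) → X} (hφ : ContinuousOn φ R) :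
    ContinuousOn (fun p : (Fin n → ℂ) × UnitAddTorus (Fin n) => φ (torusRotate p.2 p.1))
      (R ×ˢ Set.univ) :=
  hφ.comp continuous_torusRotate_uncurry.continuousOn fun p hp => hR.torusRotate_mem p.2 hp.1

theorem IsBoundedReinhardtDomain.continuous_orbit (hR : IsBoundedReinhardtDomain R)
    {X : Type*} [TopologicalSpace X] {φ : (Fin n → ℂ) → X} (hφ : ContinuousOn φ R)
    {z : Fin n → ℂ} (hz : z ∈ R) : Continuous fun θ => φ (torusRotate θ z) :=
  hφ.comp_continuous (continuous_torusRotate_left z) fun θ => hR.torusRotate_mem θ hz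

theorem IsBoundedReinhardtDomain.aemeasurable_torusRotate (hR : IsBoundedReinhardtDomain R)
    {φ : (Fin n → ℂ) → ℝ≥0∞} (hφ : ContinuousOn φ R) :
    AEMeasurable (fun p : (Fin n → ℂ) × UnitAddTorus (Fin n) => φ (torusRotate p.2 p.1))
      ((volume.restrict R).prod (torusMeasure n)) := by
  rw [Measure.restrict_prod_eq_prod_univ]
  exact (hR.continuousOn_torusRotate hφ).aemeasurable
    (hR.isOpen.measurableSet.prod MeasurableSet.univ)

/-- Averaging over torus orbits. -/
theorem IsBoundedReinhardtDomain.setLIntegral_eq_orbit (hR : IsBoundedReinhardtDomain R)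
    {φ : (Fin n → ℂ) → ℝ≥0∞} (hφ : ContinuousOn φ R) :
    ∫⁻ z in R, φ z = ∫⁻ z in R, ∫⁻ θ, φ (torusRotate θ z) ∂torusMeasure n := by
  rw [lintegral_lintegral_swap (hR.aemeasurable_torusRotate hφ)]
  simp only [hR.setLIntegral_torusRotate, lintegral_const, measure_univ, mul_one]

theorem IsBoundedReinhardtDomain.setIntegral_eq_orbit (hR : IsBoundedReinhardtDomain R)
    {φ : (Fin n → ℂ) → ℂ} (hφ : ContinuousOn φ R) (hi : IntegrableOn φ R) :
    ∫ z in R, φ z = ∫ z in R, ∫ θ, φ (torusRotate θ z) ∂torusMeasure n := by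
  have hint : Integrable (fun p : (Fin n → ℂ) × UnitAddTorus (Fin n) => φ (torusRotate p.2 p.1))
      ((volume.restrict R).prod (torusMeasure n)) := by
    refine ⟨?_, ?_⟩
    · rw [Measure.restrict_prod_eq_prod_univ]
      exact (hR.continuousOn_torusRotate hφ).aestronglyMeasurable
        (hR.isOpen.measurableSet.prod MeasurableSet.univ)
    · rw [HasFiniteIntegral, lintegral_prod _ (hR.aemeasurable_torusRotate hφ.enorm),
        ← hR.setLIntegral_eq_orbit hφ.enorm]
      exact hi.2
  rw [integral_integral_swap hint]
  simp only [hR.setIntegral_torusRotate, integral_const, probReal_univ, one_smul]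

end TorusRotate

/-! ### Holomorphic functions of several variables -/

/-- The one-variable Cauchy estimate on the complex line through `z` in the direction `v`, which
stays in the ball for parameters of modulus at most `r / ‖v‖`. -/
theorem norm_fderiv_le_of_forall_mem_closedBall {E : Type*} [NormedAddCommGroup E]
    [NormedSpace ℂ E] {f : E → ℂ} {z : E} {r M : ℝ} (hr : 0 < r) (hM : 0 ≤ M)
    (hf : ∀ y ∈ Metric.closedBall z r, DifferentiableAt ℂ f y)
    (hb : ∀ y ∈ Metric.closedBall z r, ‖f y‖ ≤ M) : ‖fderiv ℂ f z‖ ≤ M / r := by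
  refine ContinuousLinearMap.opNorm_le_bound _ (by positivity) fun v => ?_
  rcases eq_or_ne v 0 with rfl | hv
  · simp
  have hv' : 0 < ‖v‖ := norm_pos_iff.2 hv
  have hin : ∀ c ∈ Metric.closedBall (0 : ℂ) (r / ‖v‖), z + c • v ∈ Metric.closedBall z r := by
    intro c hc
    rw [mem_closedBall_zero_iff, le_div_iff₀ hv'] at hc
    rwa [mem_closedBall_iff_norm, add_sub_cancel_left, norm_smul]
  have hline : ∀ c : ℂ, HasDerivAt (fun c : ℂ => z + c • v) v c := fun c => by
    simpa using ((hasDerivAt_id c).smul_const v).const_add z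
  have hder : HasDerivAt (fun c : ℂ => f (z + c • v)) (fderiv ℂ f z v) 0 := by
    have h1 : HasFDerivAt f (fderiv ℂ f z) (z + (0 : ℂ) • v) := by
      simpa using (hf z (Metric.mem_closedBall_self hr.le)).hasFDerivAt
    exact h1.comp_hasDerivAt (0 : ℂ) (hline 0)
  have hdiff : DifferentiableOn ℂ (fun c : ℂ => f (z + c • v))
      (Metric.closedBall (0 : ℂ) (r / ‖v‖)) := fun c hc =>
    ((hf _ (hin c hc)).comp c (hline c).differentiableAt).differentiableWithinAt
  have := Complex.norm_deriv_le_of_forall_mem_sphere_norm_le (by positivity : 0 < r / ‖v‖)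
    (hdiff.diffContOnCl_ball subset_rfl)
    (fun c hc => hb _ (hin c (Metric.sphere_subset_closedBall hc)))
  rw [hder.deriv] at this
  refine this.trans (le_of_eq ?_)
  field_simp

/-- The Cauchy estimate is applied to `w ↦ f (w + (y - z)) - f w`, which is uniformly small for `y`
near `z` by uniform continuity of `f` on a compact ball. The continuity is needed to differentiate
orbit integrals. -/
theorem continuousOn_fderiv_of_differentiableOn {E : Type*} [NormedAddCommGroup E]
    [NormedSpace ℂ E] [ProperSpace E] {f : E → ℂ} {Ω : Set E} (hΩ : IsOpen Ω)
    (hf : DifferentiableOn ℂ f Ω) : ContinuousOn (fderiv ℂ f) Ω := by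
  intro z hz
  refine ContinuousAt.continuousWithinAt (Metric.continuousAt_iff.2 fun ε hε => ?_)
  obtain ⟨r', hr', hsub⟩ := Metric.nhds_basis_closedBall.mem_iff.1 (hΩ.mem_nhds hz)
  obtain ⟨r, hr, rfl⟩ : ∃ r, 0 < r ∧ 2 * r = r' := ⟨r' / 2, by positivity, by ring⟩
  have huc := (isCompact_closedBall z (2 * r)).uniformContinuousOn_of_continuous
    (hf.continuousOn.mono hsub)
  obtain ⟨δ, hδ, hd⟩ := Metric.uniformContinuousOn_iff.1 huc (ε * r / 2) (by positivity)
  refine ⟨min δ r, lt_min hδ hr, fun {y} hy => ?_⟩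
  have hyz : ‖y - z‖ < min δ r := by rwa [← dist_eq_norm]
  have hat : ∀ w ∈ Metric.closedBall z (2 * r), DifferentiableAt ℂ f w := fun w hw =>
    hf.differentiableAt (hΩ.mem_nhds (hsub hw))
  have hin : ∀ w ∈ Metric.closedBall z r, w ∈ Metric.closedBall z (2 * r) := fun w hw =>
    Metric.closedBall_subset_closedBall (by linarith) hw
  have hin' : ∀ w ∈ Metric.closedBall z r, w + (y - z) ∈ Metric.closedBall z (2 * r) := by
    intro w hw
    rw [mem_closedBall_iff_norm] at hw ⊢
    calc ‖w + (y - z) - z‖ = ‖(w - z) + (y - z)‖ := by congr 1; abel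
      _ ≤ ‖w - z‖ + ‖y - z‖ := norm_add_le _ _
      _ ≤ 2 * r := by linarith [hyz.le.trans (min_le_right δ r)]
  have hsh : ∀ w ∈ Metric.closedBall z r,
      HasFDerivAt (fun w => f (w + (y - z))) (fderiv ℂ f (w + (y - z))) w := fun w hw =>
    (hat _ (hin' w hw)).hasFDerivAt.comp w ((hasFDerivAt_id w).add_const (y - z))
  have hz0 := Metric.mem_closedBall_self (x := z) hr.le
  have hder : fderiv ℂ (fun w => f (w + (y - z)) - f w) z = fderiv ℂ f y - fderiv ℂ f z := by
    have := (hsh z hz0).sub (hat z (hin z hz0)).hasFDerivAt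
    rw [add_sub_cancel] at this
    exact this.fderiv
  rw [dist_eq_norm, ← hder]
  have := norm_fderiv_le_of_forall_mem_closedBall (f := fun w => f (w + (y - z)) - f w)
    (M := ε * r / 2) hr (by positivity)
    (fun w hw => (hsh w hw).differentiableAt.sub (hat w (hin w hw))) fun w hw => by
      have := hd _ (hin' w hw) w (hin w hw) (by
        rw [dist_eq_norm, add_sub_cancel_left]; exact hyz.trans_le (min_le_left _ _))
      rw [dist_eq_norm] at this
      exact this.le
  refine this.trans_lt ?_
  rw [div_lt_iff₀ hr]
  linarith [mul_pos hε hr]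

/-- Identity theorem for holomorphic functions of several variables. -/
theorem DifferentiableOn.eqOn_zero_of_eventuallyEq_zero {E : Type*} [NormedAddCommGroup E]
    [NormedSpace ℂ E] {f : E → ℂ} {U : Set E} (hf : DifferentiableOn ℂ f U) (hU : IsOpen U)
    (hc : IsPreconnected U) {z₀ : E} (hz₀ : z₀ ∈ U) (h0 : f =ᶠ[𝓝 z₀] 0) : Set.EqOn f 0 U := by
  have hsub : U ⊆ {z | f =ᶠ[𝓝 z] 0} := by
    -- The set of points near which `f` vanishes is open, so by connectedness it suffices that it is
    -- closed in `U`. In a ball around a limit point `z` there is a point `y` of the set; each `w`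
    -- in the ball lies on a complex line through `y`, and this line meets the ball in a convex set,
    -- where the one-variable identity theorem applies.
    refine hc.subset_of_closure_inter_subset isOpen_setOfPred_eventually_nhds ⟨z₀, hz₀, h0⟩ ?_
    rintro z ⟨hzc, hzU⟩
    obtain ⟨r, hr, hrU⟩ := Metric.isOpen_iff.1 hU z hzU
    obtain ⟨y, hy, hyz⟩ := Metric.mem_closure_iff.1 hzc r hr
    rw [dist_comm] at hyz
    refine Filter.mem_of_superset (Metric.ball_mem_nhds z hr) fun w hw => ?_
    set V : Set ℂ := {t | y + t • (w - y) ∈ Metric.ball z r} with hV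
    have hline : Continuous fun t : ℂ => y + t • (w - y) := by fun_prop
    have hVo : IsOpen V := Metric.isOpen_ball.preimage hline
    have hVc : Convex ℝ V := by
      intro a ha b hb s t hs ht hst
      have := (convex_ball z r) ha hb hs ht hst
      have hst' : (s : ℂ) + t = 1 := by exact_mod_cast hst
      have e : y + ((s : ℂ) * a + t * b) • (w - y) =
          (s : ℂ) • (y + a • (w - y)) + (t : ℂ) • (y + b • (w - y)) := by
        calc y + ((s : ℂ) * a + t * b) • (w - y)
            = ((s : ℂ) + t) • y + ((s : ℂ) * a + t * b) • (w - y) := by rw [hst', one_smul]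
          _ = _ := by module
      change y + (s • a + t • b) • (w - y) ∈ Metric.ball z r
      rw [Complex.real_smul, Complex.real_smul, e, Complex.coe_smul, Complex.coe_smul]
      exact this
    have hg : DifferentiableOn ℂ (fun t : ℂ => f (y + t • (w - y))) V :=
      hf.comp (by fun_prop) fun t ht => hrU ht
    have hev : (fun t : ℂ => f (y + t • (w - y))) =ᶠ[𝓝 0] 0 := by
      have h1 : Tendsto (fun t : ℂ => y + t • (w - y)) (𝓝 0) (𝓝 y) := by
        simpa using hline.tendsto 0
      exact h1.eventually hy
    have h1 := (hg.analyticOnNhd hVo).eqOn_zero_of_preconnected_of_eventuallyEq_zero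
      hVc.isPreconnected (z₀ := 0) (by simpa [hV] using hyz) hev (x := 1) (by simpa [hV] using hw)
    simpa using h1
  exact fun z hz => (hsub hz).self_of_nhds

/-! ### Isotypic components of holomorphic functions on Reinhardt domains -/

/-- The component of `f` of weight `α` under the torus action. -/
noncomputable def torusComponent {n : ℕ} (f : (Fin n → ℂ) → ℂ) (α : Fin n → ℤ)
    (z : Fin n → ℂ) : ℂ :=
  ∫ θ, UnitAddTorus.mFourier (-α) θ * f (torusRotate θ z) ∂torusMeasure n

section TorusComponent

variable {n : ℕ} {R : Set (Fin n → ℂ)} {f : (Fin n → ℂ) → ℂ}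

theorem mFourier_neg_mul_self (α : Fin n → ℤ) (θ : UnitAddTorus (Fin n)) :
    UnitAddTorus.mFourier (-α) θ * UnitAddTorus.mFourier α θ = 1 := by
  rw [← UnitAddTorus.mFourier_add, neg_add_cancel, UnitAddTorus.mFourier_zero,
    ContinuousMap.one_apply]

theorem torusComponent_torusRotate (f : (Fin n → ℂ) → ℂ) (α : Fin n → ℤ)
    (φ : UnitAddTorus (Fin n)) (z : Fin n → ℂ) :
    torusComponent f α (torusRotate φ z) = UnitAddTorus.mFourier α φ * torusComponent f α z := by
  unfold torusComponent
  rw [← integral_add_right_eq_self (μ := torusMeasure n)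
    (fun θ => UnitAddTorus.mFourier (-α) θ * f (torusRotate θ z)) φ, ← integral_const_mul]
  refine integral_congr_ae (ae_of_all _ fun θ => ?_)
  dsimp only
  rw [mFourier_apply_add, torusRotate_add]
  linear_combination (-UnitAddTorus.mFourier (-α) θ * f (torusRotate θ (torusRotate φ z))) *
    mFourier_neg_mul_self α φ

theorem integrable_of_continuous_torus {E : Type*} [NormedAddCommGroup E]
    {g : UnitAddTorus (Fin n) → E} (hg : Continuous g) : Integrable g (torusMeasure n) :=
  hg.integrable_of_hasCompactSupport (HasCompactSupport.of_compactSpace g)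

/-- The rotation by `θ` as a linear map. -/
noncomputable def torusRotateCLM (θ : UnitAddTorus (Fin n)) : (Fin n → ℂ) →L[ℂ] (Fin n → ℂ) :=
  ∑ j, ((θ j).toCircle : ℂ) •
    (ContinuousLinearMap.single ℂ (fun _ : Fin n => ℂ) j).comp (ContinuousLinearMap.proj j)

theorem torusRotateCLM_apply (θ : UnitAddTorus (Fin n)) (z : Fin n → ℂ) :
    torusRotateCLM θ z = torusRotate θ z := by
  ext i
  simp only [torusRotateCLM, torusRotate, _root_.sum_apply,
    _root_.smul_apply, ContinuousLinearMap.comp_apply, Finset.sum_apply,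
    Pi.smul_apply, ContinuousLinearMap.single_apply, ContinuousLinearMap.proj_apply, smul_eq_mul]
  rw [Finset.sum_eq_single i]
  · simp
  · intro j _ hj
    rw [Pi.single_eq_of_ne hj.symm, mul_zero]
  · simp

theorem continuous_torusRotateCLM :
    Continuous (torusRotateCLM : UnitAddTorus (Fin n) → (Fin n → ℂ) →L[ℂ] (Fin n → ℂ)) :=
  continuous_finsetSum _ fun j _ =>
    (continuous_toCircle_coe.comp (continuous_apply j)).smul continuous_const

/-- Differentiation under the integral sign: the derivative of the integrand is jointly continuous,
hence bounded on the product of a closed ball with the compact torus. -/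
theorem IsBoundedReinhardtDomain.differentiableOn_torusComponent
    (hR : IsBoundedReinhardtDomain R) (hf : DifferentiableOn ℂ f R) (α : Fin n → ℤ) :
    DifferentiableOn ℂ (torusComponent f α) R := by
  intro z₀ hz₀
  obtain ⟨r, hr, hsub⟩ := Metric.nhds_basis_closedBall.mem_iff.1 (hR.isOpen.mem_nhds hz₀)
  set F' : (Fin n → ℂ) → UnitAddTorus (Fin n) → (Fin n → ℂ) →L[ℂ] ℂ := fun z θ =>
    UnitAddTorus.mFourier (-α) θ • (fderiv ℂ f (torusRotate θ z)).comp (torusRotateCLM θ) with hF'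
  have hcont : ContinuousOn (fun p : (Fin n → ℂ) × UnitAddTorus (Fin n) => F' p.1 p.2)
      (R ×ˢ Set.univ) := by
    have h1 := hR.continuousOn_torusRotate (continuousOn_fderiv_of_differentiableOn hR.isOpen hf)
    have h2 : Continuous fun p : (Fin n → ℂ) × UnitAddTorus (Fin n) => torusRotateCLM p.2 :=
      continuous_torusRotateCLM.comp continuous_snd
    have h3 : Continuous fun p : (Fin n → ℂ) × UnitAddTorus (Fin n) =>
      UnitAddTorus.mFourier (-α) p.2 := (UnitAddTorus.mFourier (-α)).continuous.comp continuous_snd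
    exact h3.continuousOn.smul (h1.clm_comp h2.continuousOn)
  obtain ⟨M, hM⟩ := ((isCompact_closedBall z₀ r).prod
    (isCompact_univ (X := UnitAddTorus (Fin n)))).exists_bound_of_continuousOn
    (hcont.mono (Set.prod_mono hsub subset_rfl))
  have hc0 : ∀ z ∈ R, Continuous fun θ =>
      UnitAddTorus.mFourier (-α) θ * f (torusRotate θ z) := fun z hz =>
    (UnitAddTorus.mFourier (-α)).continuous.mul (hR.continuous_orbit hf.continuousOn hz)
  have hc1 : Continuous (F' z₀) :=
    hcont.comp_continuous (continuous_const.prodMk continuous_id) fun θ => ⟨hz₀, trivial⟩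
  have hder : HasFDerivAt (fun z => ∫ θ, UnitAddTorus.mFourier (-α) θ * f (torusRotate θ z)
      ∂torusMeasure n) (∫ θ, F' z₀ θ ∂torusMeasure n) z₀ := by
    refine hasFDerivAt_integral_of_dominated_of_fderiv_le (𝕜 := ℂ)
      (F := fun z θ => UnitAddTorus.mFourier (-α) θ * f (torusRotate θ z)) (F' := F')
      (bound := fun _ => M) (Metric.closedBall_mem_nhds z₀ hr) ?_
      (integrable_of_continuous_torus (hc0 z₀ hz₀))
      (integrable_of_continuous_torus hc1).aestronglyMeasurable
      (ae_of_all _ fun θ z hz => hM (z, θ) ⟨hz, trivial⟩) (integrable_const M)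
      (ae_of_all _ fun θ z hz => ?_)
    · filter_upwards [hR.isOpen.mem_nhds hz₀] with z hz
      exact (integrable_of_continuous_torus (hc0 z hz)).aestronglyMeasurable
    · have h1 : HasFDerivAt (torusRotate θ) (torusRotateCLM θ) z := by
        have := (torusRotateCLM θ).hasFDerivAt (x := z)
        rwa [show ⇑(torusRotateCLM θ) = torusRotate θ from
          funext (torusRotateCLM_apply θ)] at this
      have h2 := hf.differentiableAt (hR.isOpen.mem_nhds (hR.torusRotate_mem θ (hsub hz)))
      exact (h2.hasFDerivAt.comp z h1).const_mul _
  exact hder.differentiableAt.differentiableWithinAt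

theorem differentiableAt_laurentMonomial {α : Fin n → ℤ} {z : Fin n → ℂ}
    (h : ∀ j, z j ≠ 0 ∨ 0 ≤ α j) : DifferentiableAt ℂ (laurentMonomial α) z := by
  unfold laurentMonomial
  have hj : ∀ j, DifferentiableAt ℂ (fun w : Fin n → ℂ => w j ^ α j) z := fun j =>
    DifferentiableAt.zpow (differentiableAt_apply j z) (h j)
  exact (HasFDerivAt.finsetProd fun j _ => (hj j).hasFDerivAt).differentiableAt

theorem laurentMonomial_ne_zero {α : Fin n → ℤ} {z : Fin n → ℂ} (h : ∀ j, z j ≠ 0) :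
    laurentMonomial α z ≠ 0 :=
  Finset.prod_ne_zero_iff.2 fun j _ => zpow_ne_zero _ (h j)

theorem laurentMonomial_neg_mul {α : Fin n → ℤ} {z : Fin n → ℂ} (h : ∀ j, z j ≠ 0) :
    laurentMonomial (-α) z * laurentMonomial α z = 1 := by
  rw [laurentMonomial, laurentMonomial, ← Finset.prod_mul_distrib]
  refine Finset.prod_eq_one fun j _ => ?_
  rw [← zpow_add₀ (h j), Pi.neg_apply, neg_add_cancel, zpow_zero]

theorem hasDerivAt_torusRotate_single (j : Fin n) (z : Fin n → ℂ) :
    HasDerivAt (fun s : ℝ => torusRotate (Pi.single j (s : UnitAddCircle)) z)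
      (Pi.single j (2 * Real.pi * Complex.I * z j)) 0 := by
  rw [hasDerivAt_pi]
  intro i
  rcases eq_or_ne i j with rfl | hij
  · simp only [torusRotate, Pi.single_eq_same, AddCircle.toCircle_apply_mk, Circle.coe_exp]
    have h1 : HasDerivAt (fun s : ℝ => ((2 * Real.pi / 1 * s : ℝ) : ℂ) * Complex.I)
        (2 * Real.pi * Complex.I) 0 := by
      have := ((hasDerivAt_id (0 : ℝ)).const_mul (2 * Real.pi / 1)).ofReal_comp.mul_const Complex.I
      simpa using this
    simpa using h1.cexp.mul_const (z i)
  · have : (fun s : ℝ => torusRotate (Pi.single j (s : UnitAddCircle)) z i) = fun _ => z i := by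
      ext s
      simp [torusRotate, hij]
    rw [this, Pi.single_eq_of_ne hij]
    exact hasDerivAt_const _ _

/-- A function invariant under rotations has vanishing derivative off the coordinate hyperplanes. -/
theorem fderiv_eq_zero_of_torusRotate_invariant {g : (Fin n → ℂ) → ℂ} {z : Fin n → ℂ}
    (hg : DifferentiableAt ℂ g z) (hz : ∀ j, z j ≠ 0)
    (hinv : ∀ θ, g (torusRotate θ z) = g z) : fderiv ℂ g z = 0 := by
  have hsingle : ∀ j, fderiv ℂ g z (Pi.single j (2 * Real.pi * Complex.I * z j)) = 0 := by
    intro j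
    have h0 : torusRotate (Pi.single j ((0 : ℝ) : UnitAddCircle)) z = z := by
      simp [torusRotate_zero]
    have h1 : HasFDerivAt g ((fderiv ℂ g z).restrictScalars ℝ)
        (torusRotate (Pi.single j ((0 : ℝ) : UnitAddCircle)) z) := by
      rw [h0]; exact hg.hasFDerivAt.restrictScalars ℝ
    have h2 := h1.comp_hasDerivAt (0 : ℝ) (hasDerivAt_torusRotate_single j z)
    have h3 : (g ∘ fun s : ℝ => torusRotate (Pi.single j (s : UnitAddCircle)) z) =
        fun _ => g z := funext fun s => hinv _
    rw [h3] at h2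
    exact h2.unique (hasDerivAt_const _ _)
  ext v
  rw [_root_.zero_apply, ← Finset.univ_sum_single v, map_sum]
  -- The rotations give the vanishing only in the directions `2πi z_j` of the coordinate axes. Since
  -- `z_j ≠ 0`, complex linearity extends it to the whole `j`-th axis.
  refine Finset.sum_eq_zero fun j _ => ?_
  have hne : 2 * Real.pi * Complex.I * z j ≠ 0 := by
    simp [hz j, Real.pi_ne_zero]
  have : (Pi.single j (v j) : Fin n → ℂ) =
      (v j / (2 * Real.pi * Complex.I * z j)) • Pi.single j (2 * Real.pi * Complex.I * z j) := by
    rw [← Pi.single_smul, smul_eq_mul, div_mul_cancel₀ _ hne]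
  rw [this, map_smul, hsingle, smul_zero]

/-- The product of the component with `e_{-α}` has weight zero, that is, it is invariant under
rotations. Its derivative therefore vanishes on a ball avoiding the coordinate hyperplanes, and it
is constant there. -/
theorem IsBoundedReinhardtDomain.torusComponent_eventuallyEq (hR : IsBoundedReinhardtDomain R)
    (hf : DifferentiableOn ℂ f R) (α : Fin n → ℤ) {z₀ : Fin n → ℂ} (hz₀ : z₀ ∈ R)
    (hne : ∀ j, z₀ j ≠ 0) :
    ∃ a : ℂ, ∀ᶠ z in 𝓝 z₀, torusComponent f α z = a * laurentMonomial α z := by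
  have hopen : IsOpen (R ∩ {z | ∀ j, z j ≠ 0}) := by
    refine hR.isOpen.inter ?_
    simp only [Set.ofPred_forall]
    exact isOpen_iInter_of_finite fun j => isOpen_ne_fun (continuous_apply j) continuous_const
  obtain ⟨r, hr, hsub⟩ := Metric.isOpen_iff.1 hopen z₀ ⟨hz₀, hne⟩
  set G : (Fin n → ℂ) → ℂ := fun z => torusComponent f α z * laurentMonomial (-α) z with hG
  have hGd : ∀ z ∈ Metric.ball z₀ r, DifferentiableAt ℂ G z := fun z hz =>
    ((hR.differentiableOn_torusComponent hf α).differentiableAt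
      (hR.isOpen.mem_nhds (hsub hz).1)).mul
      (differentiableAt_laurentMonomial fun j => Or.inl ((hsub hz).2 j))
  have hG0 : Set.EqOn (fderiv ℂ G) 0 (Metric.ball z₀ r) := fun z hz => by
    refine fderiv_eq_zero_of_torusRotate_invariant (hGd z hz) (hsub hz).2 fun θ => ?_
    simp only [hG, torusComponent_torusRotate, laurentMonomial_torusRotate]
    linear_combination (torusComponent f α z * laurentMonomial (-α) z) * mFourier_neg_mul_self α θ
  refine ⟨G z₀, ?_⟩
  filter_upwards [Metric.ball_mem_nhds z₀ hr] with z hz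
  rw [Metric.isOpen_ball.is_const_of_fderiv_eq_zero (convex_ball z₀ r).isPreconnected
    (fun w hw => (hGd w hw).differentiableWithinAt) hG0 (Metric.mem_ball_self hr) hz, hG,
    mul_assoc, laurentMonomial_neg_mul (hsub hz).2, mul_one]

end TorusComponent

/-! ### Laurent coefficients and the coordinate hyperplanes -/

section LaurentCoefficient

variable {n : ℕ} {R : Set (Fin n → ℂ)} {f : (Fin n → ℂ) → ℂ}

/-- In an open set, all coordinates but a prescribed one can be made nonzero. -/
theorem IsOpen.exists_coord_ne_zero (hR : IsOpen R) {z : Fin n → ℂ} (hz : z ∈ R)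
    (J : Set (Fin n)) : ∃ w ∈ R, (∀ j ∈ J, w j = z j) ∧ ∀ j ∉ J, w j ≠ 0 := by
  classical
  set γ : ℝ → Fin n → ℂ := fun ε j => if z j = 0 ∧ j ∉ J then (ε : ℂ) else z j with hγ
  have hc : Continuous γ := by
    refine continuous_pi fun j => ?_
    by_cases h : z j = 0 ∧ j ∉ J
    · simp only [hγ, if_pos h]; exact Complex.continuous_ofReal
    · simp only [hγ, if_neg h]; exact continuous_const
  have h0 : γ 0 = z := by
    ext j
    by_cases h : z j = 0 ∧ j ∉ J
    · simp [hγ, if_pos h, h.1]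
    · simp only [hγ, if_neg h]
  have hev : ∀ᶠ ε in 𝓝[>] (0 : ℝ), γ ε ∈ R :=
    tendsto_nhdsWithin_of_tendsto_nhds (hc.tendsto 0)
      (by rw [h0]; exact hR.mem_nhds hz)
  obtain ⟨ε, hε, hpos⟩ := (hev.and eventually_mem_nhdsWithin).exists
  have hpos : 0 < ε := hpos
  refine ⟨γ ε, hε, fun j hj => ?_, fun j hj => ?_⟩
  · simp [hγ, hj]
  · by_cases h : z j = 0
    · simp [hγ, h, hj, hpos.ne']
    · simp [hγ, h]

/-- Clearing denominators: both products of natural powers are entire, so identities between them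
make sense across the coordinate hyperplanes. -/
theorem laurentMonomial_mul_prod_neg {α : Fin n → ℤ} {z : Fin n → ℂ}
    (h : ∀ j, z j ≠ 0 ∨ 0 ≤ α j) :
    laurentMonomial α z * ∏ j, z j ^ (-α j).toNat = ∏ j, z j ^ (α j).toNat := by
  rw [laurentMonomial, ← Finset.prod_mul_distrib]
  refine Finset.prod_congr rfl fun j _ => ?_
  rw [← zpow_natCast, ← zpow_natCast]
  rcases le_or_gt 0 (α j) with hj | hj
  · rw [show (((-α j).toNat : ℕ) : ℤ) = 0 by omega, zpow_zero, mul_one, Int.toNat_of_nonneg hj]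
  · rw [← zpow_add₀ ((h j).resolve_right (by omega))]
    congr 1
    omega

/-- The isotypic component of weight `α` of a holomorphic function is a multiple of `e_α`, and it
vanishes if `e_α` is not holomorphic. -/
theorem IsBoundedReinhardtDomain.exists_torusComponent_eq (hR : IsBoundedReinhardtDomain R)
    (hf : DifferentiableOn ℂ f R) (α : Fin n → ℤ) :
    ∃ a : ℂ, (∀ z ∈ R, torusComponent f α z = a * laurentMonomial α z) ∧
      (a ≠ 0 → ∀ z ∈ R, ∀ j, z j ≠ 0 ∨ 0 ≤ α j) := by
  obtain ⟨z₁, hz₁⟩ := hR.isConnected.nonempty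
  obtain ⟨z₀, hz₀, -, hne⟩ := hR.isOpen.exists_coord_ne_zero hz₁ ∅
  have hne : ∀ j, z₀ j ≠ 0 := fun j => hne j (Set.notMem_empty j)
  obtain ⟨a, ha⟩ := hR.torusComponent_eventuallyEq hf α hz₀ hne
  have hFd := hR.differentiableOn_torusComponent hf α
  rcases eq_or_ne a 0 with rfl | ha0
  · refine ⟨0, fun z hz => ?_, fun h => absurd rfl h⟩
    rw [zero_mul]
    exact hFd.eqOn_zero_of_eventuallyEq_zero hR.isOpen hR.isConnected.isPreconnected hz₀
      (ha.mono fun z hz => by simpa using hz) hz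
  -- With denominators cleared both sides are holomorphic on all of `R`. They agree near `z₀`, hence
  -- everywhere by the identity theorem.
  have hid : ∀ z ∈ R, torusComponent f α z * ∏ j, z j ^ (-α j).toNat =
      a * ∏ j, z j ^ (α j).toNat := by
    have hd : DifferentiableOn ℂ (fun z => torusComponent f α z * ∏ j, z j ^ (-α j).toNat -
        a * ∏ j, z j ^ (α j).toNat) R := by
      have hp : ∀ m : Fin n → ℕ, Differentiable ℂ fun z : Fin n → ℂ => ∏ j, z j ^ m j := by
        intro m z
        have hj : ∀ j, DifferentiableAt ℂ (fun w : Fin n → ℂ => w j ^ m j) z := fun j => by fun_prop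
        exact (HasFDerivAt.finsetProd fun j _ => (hj j).hasFDerivAt).differentiableAt
      exact (hFd.mul (hp _).differentiableOn).sub ((hp _).differentiableOn.const_mul a)
    have hnear : ∀ᶠ z in 𝓝 z₀, ∀ j, z j ≠ 0 := by
      rw [eventually_all]
      exact fun j => (continuous_apply j).continuousAt.eventually_ne (hne j)
    have := hd.eqOn_zero_of_eventuallyEq_zero hR.isOpen hR.isConnected.isPreconnected hz₀ (by
      filter_upwards [ha, hnear] with z hz hz'
      rw [hz, mul_assoc, laurentMonomial_mul_prod_neg fun j => Or.inl (hz' j)]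
      simp)
    exact fun z hz => sub_eq_zero.1 (this hz)
  -- Suppose `z j = 0` and `α j < 0` at some point of `R`. Move the other coordinates away from
  -- zero: the left side of `hid` still vanishes, through its `j`-th factor, whereas the right side
  -- is not zero because its exponent at `j` is `0`.
  have hgood : ∀ z ∈ R, ∀ j, z j ≠ 0 ∨ 0 ≤ α j := by
    intro z hz j
    by_contra! hcon
    obtain ⟨w, hw, hwj, hwne⟩ := hR.isOpen.exists_coord_ne_zero hz {j}
    have h1 := hid w hw
    have hwj' : w j = 0 := (hwj j rfl).trans hcon.1
    rw [Finset.prod_eq_zero (Finset.mem_univ j) (by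
      rw [hwj', zero_pow (by omega)]), mul_zero] at h1
    refine (mul_ne_zero ha0 (Finset.prod_ne_zero_iff.2 fun i _ => ?_)) h1.symm
    rcases eq_or_ne i j with rfl | hij
    · rw [Int.toNat_of_nonpos hcon.2.le, pow_zero]; exact one_ne_zero
    · exact pow_ne_zero _ (hwne i hij)
  refine ⟨a, fun z hz => ?_, fun _ => hgood⟩
  -- By `hgood`, a coordinate that vanishes carries the exponent `0` here, so one may divide at
  -- every point of `R`.
  have hp : ∏ j, z j ^ (-α j).toNat ≠ 0 := by
    refine Finset.prod_ne_zero_iff.2 fun j _ => ?_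
    rcases hgood z hz j with h | h
    · exact pow_ne_zero _ h
    · rw [Int.toNat_of_nonpos (by omega), pow_zero]; exact one_ne_zero
  refine mul_right_cancel₀ hp ?_
  rw [hid z hz, mul_assoc, laurentMonomial_mul_prod_neg (hgood z hz)]

end LaurentCoefficient

/-! ### Laurent expansions -/

/-- Any finite set of multi-indices lies in a box, over which the sum of products is a product of
one-dimensional geometric sums. -/
theorem summable_prod_exp_neg_abs (n : ℕ) {ε : ℝ} (hε : 0 < ε) :
    Summable fun α : Fin n → ℤ => ∏ j, Real.exp (-(ε * |(α j : ℝ)|)) := by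
  set u : ℤ → ℝ := fun k => Real.exp (-(ε * |(k : ℝ)|)) with hu
  have hun : Summable fun m : ℕ => u m := by
    have : (fun m : ℕ => u m) = fun m : ℕ => Real.exp (-ε) ^ m := by
      ext m
      rw [hu, ← Real.exp_nat_mul]
      simp only [Int.cast_natCast, Nat.abs_cast]
      ring_nf
    rw [this]
    exact summable_geometric_of_lt_one (Real.exp_pos _).le (Real.exp_lt_one_iff.2 (by linarith))
  have hus : Summable u := Summable.of_nat_of_neg hun (by simpa [hu] using hun)
  have hu0 : ∀ k, 0 ≤ u k := fun k => (Real.exp_pos _).le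
  refine summable_of_sum_le (c := (∑' k, u k) ^ n)
    (fun α => Finset.prod_nonneg fun j _ => hu0 (α j)) fun s => ?_
  obtain ⟨N, hN⟩ := ((tendsto_squareBox_atTop n).eventually_ge_atTop s).exists
  calc ∑ α ∈ s, ∏ j, u (α j) ≤ ∑ α ∈ squareBox n N, ∏ j, u (α j) :=
        Finset.sum_le_sum_of_subset_of_nonneg hN
          fun α _ _ => Finset.prod_nonneg fun j _ => hu0 (α j)
    _ = ∏ _j : Fin n, ∑ k ∈ Finset.Icc (-(N : ℤ)) N, u k :=
        Finset.sum_prod_piFinset _ fun _ => u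
    _ ≤ ∏ _j : Fin n, ∑' k, u k :=
        Finset.prod_le_prod (fun _ _ => Finset.sum_nonneg fun k _ => hu0 k)
          fun _ _ => hus.sum_le_tsum _ fun k _ => hu0 k
    _ = _ := by simp

theorem integral_mFourier_torus {n : ℕ} (α : Fin n → ℤ) :
    ∫ θ, UnitAddTorus.mFourier α θ ∂torusMeasure n = if α = 0 then 1 else 0 := by
  simp only [UnitAddTorus.mFourier, ContinuousMap.coe_mk]
  rw [integral_fintype_prod_eq_prod (fun j (x : UnitAddCircle) => (fourier (α j) x : ℂ))]
  simp only [integral_fourier_circle]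
  rw [Finset.prod_ite_zero]
  simp [funext_iff]

section Laurent

variable {n : ℕ} {R : Set (Fin n → ℂ)} {f : (Fin n → ℂ) → ℂ}

theorem norm_torusComponent_le {z : Fin n → ℂ} {M : ℝ} (α : Fin n → ℤ)
    (hM : ∀ θ, ‖f (torusRotate θ z)‖ ≤ M) : ‖torusComponent f α z‖ ≤ M := by
  have := norm_integral_le_of_norm_le_const (μ := torusMeasure n) (C := M)
    (f := fun θ => UnitAddTorus.mFourier (-α) θ * f (torusRotate θ z))
    (ae_of_all _ fun θ => by rw [norm_mul, norm_mFourier_apply, one_mul]; exact hM θ)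
  rw [probReal_univ, mul_one] at this
  exact this

/-- Cauchy estimates for the isotypic components on a compact set. -/
theorem IsBoundedReinhardtDomain.exists_norm_torusComponent_le (hR : IsBoundedReinhardtDomain R)
    (hf : DifferentiableOn ℂ f R) {K : Set (Fin n → ℂ)} (hKR : K ⊆ R) (hK : IsCompact K) :
    ∃ M ε : ℝ, 0 < ε ∧ ∀ z ∈ K, ∀ α : Fin n → ℤ,
      ‖torusComponent f α z‖ ≤ M * ∏ j, Real.exp (-(ε * |(α j : ℝ)|)) := by
  -- Coordinatewise dilation by `e^{t_j}`. By compactness, `K` stays inside `R` for all small `t` at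
  -- once; these dilations play the part of the varying radii in Cauchy's estimates.
  set σ : (Fin n → ℝ) × (Fin n → ℂ) → Fin n → ℂ :=
    fun p j => (Real.exp (p.1 j) : ℂ) * p.2 j with hσ
  have hσc : Continuous σ := by
    refine continuous_pi fun j => ?_
    have : Continuous fun p : (Fin n → ℝ) × (Fin n → ℂ) => Real.exp (p.1 j) := by fun_prop
    exact (Complex.continuous_ofReal.comp this).mul (by fun_prop)
  have hev : ∀ᶠ t in 𝓝 (0 : Fin n → ℝ), ∀ z ∈ K, σ (t, z) ∈ R := by
    refine hK.eventually_forall_of_forall_eventually fun z hz => ?_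
    have h0 : σ (0, z) = z := by ext j; simp [hσ]
    exact hσc.continuousAt.eventually (by rw [h0]; exact hR.isOpen.mem_nhds (hKR hz))
  obtain ⟨ε, hε, hεR⟩ := Metric.nhds_basis_closedBall.eventually_iff.1 hev
  have hcont : ContinuousOn (fun p : ((Fin n → ℝ) × (Fin n → ℂ)) × UnitAddTorus (Fin n) =>
      f (torusRotate p.2 (σ p.1))) ((Metric.closedBall 0 ε ×ˢ K) ×ˢ Set.univ) :=
    (hR.continuousOn_torusRotate hf.continuousOn).comp
      (f := fun p : ((Fin n → ℝ) × (Fin n → ℂ)) × UnitAddTorus (Fin n) => (σ p.1, p.2))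
      (by fun_prop) fun p hp => ⟨hεR hp.1.1 _ hp.1.2, trivial⟩
  obtain ⟨M, hM⟩ := (((isCompact_closedBall (0 : Fin n → ℝ) ε).prod hK).prod
    (isCompact_univ (X := UnitAddTorus (Fin n)))).exists_bound_of_continuousOn hcont
  refine ⟨M, ε, hε, fun z hz α => ?_⟩
  obtain ⟨a, ha, -⟩ := hR.exists_torusComponent_eq hf α
  -- Each coordinate is dilated or contracted according to the sign of `α j`, so that `e_α` grows by
  -- exactly `∏ exp (ε |α_j|)`. The bound `M` at the moved point then yields the decay at `z`.
  set t : Fin n → ℝ := fun j => ε * (SignType.sign (α j : ℝ) : ℝ) with ht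
  have htmem : t ∈ Metric.closedBall (0 : Fin n → ℝ) ε := by
    rw [mem_closedBall_zero_iff, pi_norm_le_iff_of_nonneg hε.le]
    intro j
    rw [ht, norm_mul, Real.norm_of_nonneg hε.le]
    refine mul_le_of_le_one_right hε.le ?_
    rcases lt_trichotomy (α j : ℝ) 0 with h | h | h
    · simp [sign_neg h]
    · simp [h]
    · simp [sign_pos h]
  have h1 : ‖torusComponent f α (σ (t, z))‖ ≤ M :=
    norm_torusComponent_le α fun θ => hM ((t, z), θ) ⟨⟨htmem, hz⟩, trivial⟩
  have h2 : laurentMonomial α (σ (t, z)) =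
      ((∏ j, Real.exp (ε * |(α j : ℝ)|) : ℝ) : ℂ) * laurentMonomial α z := by
    simp only [laurentMonomial, hσ, mul_zpow, Finset.prod_mul_distrib, Complex.ofReal_prod]
    congr 1
    refine Finset.prod_congr rfl fun j _ => ?_
    have h : (α j : ℝ) * t j = ε * |(α j : ℝ)| := by
      rw [← sign_mul_self (α j : ℝ), ht]
      ring
    rw [← h, Complex.ofReal_exp, Complex.ofReal_exp, ← Complex.exp_int_mul]
    push_cast
    rfl
  have h3 : torusComponent f α (σ (t, z)) =
      ((∏ j, Real.exp (ε * |(α j : ℝ)|) : ℝ) : ℂ) * torusComponent f α z := by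
    rw [ha _ (hεR htmem z hz), ha z (hKR hz), h2]
    ring
  have hpos : 0 < ∏ j, Real.exp (ε * |(α j : ℝ)|) := Finset.prod_pos fun j _ => Real.exp_pos _
  rw [h3, norm_mul, Complex.norm_real, Real.norm_of_nonneg hpos.le] at h1
  simp only [Real.exp_neg, Finset.prod_inv_distrib]
  rw [← div_eq_mul_inv, le_div_iff₀ hpos, mul_comm]
  exact h1

theorem IsBoundedReinhardtDomain.summable_norm_torusComponent (hR : IsBoundedReinhardtDomain R)
    (hf : DifferentiableOn ℂ f R) {z : Fin n → ℂ} (hz : z ∈ R) :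
    Summable fun α => ‖torusComponent f α z‖ := by
  obtain ⟨M, ε, hε, h⟩ := hR.exists_norm_torusComponent_le hf
    (Set.singleton_subset_iff.2 hz) isCompact_singleton
  exact Summable.of_nonneg_of_le (fun _ => norm_nonneg _) (h z rfl)
    ((summable_prod_exp_neg_abs n hε).mul_left M)

/-- The components at `z` are the Fourier coefficients of the continuous function `θ ↦ f (θ · z)`.
As they are absolutely summable, the Fourier series converges to the function at every point. -/
theorem IsBoundedReinhardtDomain.hasSum_torusComponent (hR : IsBoundedReinhardtDomain R)
    (hf : DifferentiableOn ℂ f R) {z : Fin n → ℂ} (hz : z ∈ R) (θ : UnitAddTorus (Fin n)) :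
    HasSum (fun α => torusComponent f α z * UnitAddTorus.mFourier α θ) (f (torusRotate θ z)) :=
  UnitAddTorus.hasSum_mFourier_series_apply_of_summable
    (f := ⟨fun θ => f (torusRotate θ z), hR.continuous_orbit hf.continuousOn hz⟩)
    (hR.summable_norm_torusComponent hf hz).of_norm θ

theorem IsBoundedReinhardtDomain.isLaurentExpansion (hR : IsBoundedReinhardtDomain R)
    (hf : DifferentiableOn ℂ f R) {a : (Fin n → ℤ) → ℂ}
    (ha : ∀ α, ∀ z ∈ R, torusComponent f α z = a α * laurentMonomial α z) :
    IsLaurentExpansion R f a := by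
  intro K hKR hK
  obtain ⟨M, ε, hε, h⟩ := hR.exists_norm_torusComponent_le hf hKR hK
  refine (HasSumUniformlyOn.of_norm_le_summable ((summable_prod_exp_neg_abs n hε).mul_left M)
    fun α z hz => ?_).congr_right fun z hz => ?_
  · rw [← ha α z (hKR hz)]
    exact h z hz α
  · have := hR.hasSum_torusComponent hf (hKR hz) 0
    simp only [UnitAddTorus.mFourier, ContinuousMap.coe_mk, Pi.zero_apply, fourier_eval_zero,
      Finset.prod_const_one, mul_one, torusRotate_zero] at this
    rw [← this.tsum_eq]
    exact tsum_congr fun α => (ha α z (hKR hz)).symm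

/-- The orbit of `z` is compact, so the expansion converges uniformly on it and may be integrated
against a character; orthogonality singles out the term of index `α`. This forces the coefficients
of any expansion. -/
theorem IsBoundedReinhardtDomain.torusComponent_eq_of_isLaurentExpansion
    (hR : IsBoundedReinhardtDomain R) (hf : DifferentiableOn ℂ f R) {a : (Fin n → ℤ) → ℂ}
    (ha : IsLaurentExpansion R f a) (α : Fin n → ℤ) {z : Fin n → ℂ} (hz : z ∈ R) :
    torusComponent f α z = a α * laurentMonomial α z := by
  have hK : IsCompact (Set.range fun θ : UnitAddTorus (Fin n) => torusRotate θ z) :=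
    isCompact_range (continuous_torusRotate_left z)
  have hunif := hasSumUniformlyOn_iff_tendstoUniformlyOn.1 (ha _ (by
    rintro _ ⟨θ, rfl⟩
    exact hR.torusRotate_mem θ hz) hK)
  rw [Metric.tendstoUniformlyOn_iff] at hunif
  refine eq_of_forall_dist_le fun ε hε => ?_
  obtain ⟨s, hs, hαs⟩ := ((hunif ε hε).and (eventually_ge_atTop {α})).exists
  have hαs : α ∈ s := by simpa using hαs
  have hfc := hR.continuous_orbit hf.continuousOn hz
  have hsum : ∫ θ, UnitAddTorus.mFourier (-α) θ * ∑ β ∈ s, a β * laurentMonomial β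
      (torusRotate θ z) ∂torusMeasure n = a α * laurentMonomial α z := by
    have : ∀ θ, UnitAddTorus.mFourier (-α) θ * ∑ β ∈ s, a β * laurentMonomial β (torusRotate θ z) =
        ∑ β ∈ s, (a β * laurentMonomial β z) * UnitAddTorus.mFourier (-α + β) θ := fun θ => by
      rw [Finset.mul_sum]
      refine Finset.sum_congr rfl fun β _ => ?_
      rw [laurentMonomial_torusRotate, UnitAddTorus.mFourier_add]
      ring
    simp only [this]
    rw [integral_finsetSum _ fun β _ => integrable_of_continuous_torus (by fun_prop)]
    simp only [integral_const_mul, integral_mFourier_torus, mul_ite, mul_one, mul_zero]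
    rw [Finset.sum_eq_single α]
    · simp
    · intro β _ hβ
      rw [if_neg]
      intro h
      exact hβ (neg_add_eq_zero.1 h).symm
    · exact fun h => absurd hαs h
  have hcs : Continuous fun θ : UnitAddTorus (Fin n) =>
      ∑ β ∈ s, a β * laurentMonomial β (torusRotate θ z) := by
    simp only [laurentMonomial_torusRotate]
    fun_prop
  have hi : ∀ {g : UnitAddTorus (Fin n) → ℂ}, Continuous g → Integrable
      (fun θ => UnitAddTorus.mFourier (-α) θ * g θ) (torusMeasure n) := fun hg =>
    integrable_of_continuous_torus ((UnitAddTorus.mFourier (-α)).continuous.mul hg)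
  rw [dist_eq_norm, ← hsum, torusComponent, ← integral_sub (hi hfc) (hi hcs)]
  have := norm_integral_le_of_norm_le_const (μ := torusMeasure n) (C := ε)
    (f := fun θ => UnitAddTorus.mFourier (-α) θ * f (torusRotate θ z) -
      UnitAddTorus.mFourier (-α) θ * ∑ β ∈ s, a β * laurentMonomial β (torusRotate θ z))
    (ae_of_all _ fun θ => by
      rw [← mul_sub, norm_mul, norm_mFourier_apply, one_mul, ← dist_eq_norm]
      exact (hs _ ⟨θ, rfl⟩).le)
  simpa using this

theorem IsBoundedReinhardtDomain.existsUnique_isLaurentExpansion (hR : IsBoundedReinhardtDomain R)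
    (hf : DifferentiableOn ℂ f R) : ∃! a : (Fin n → ℤ) → ℂ, IsLaurentExpansion R f a := by
  choose a ha _ using hR.exists_torusComponent_eq hf
  have hexp := hR.isLaurentExpansion hf ha
  refine ⟨a, hexp, fun b hb => funext fun α => ?_⟩
  obtain ⟨z₁, hz₁⟩ := hR.isConnected.nonempty
  obtain ⟨z, hz, -, hne⟩ := hR.isOpen.exists_coord_ne_zero hz₁ ∅
  refine mul_right_cancel₀ (laurentMonomial_ne_zero (α := α)
    fun j => hne j (Set.notMem_empty j)) ?_
  rw [← hR.torusComponent_eq_of_isLaurentExpansion hf hb α hz, ha α z hz]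

/-- On each orbit, a probability space, the component is bounded by the `L^1` mean of `f`, hence by
its `L^p` mean. Integrating over `R` gives the claim. -/
theorem IsBoundedReinhardtDomain.memLp_torusComponent (hR : IsBoundedReinhardtDomain R)
    {p : ℝ≥0∞} (hp1 : 1 ≤ p) (hp : p ≠ ∞) (hf : MemBergman R p f) (α : Fin n → ℤ) :
    MemLp (torusComponent f α) p (volume.restrict R) := by
  have hp0 : p ≠ 0 := (zero_lt_one.trans_le hp1).ne'
  have hq : 0 < p.toReal := ENNReal.toReal_pos hp0 hp
  refine ⟨(hR.differentiableOn_torusComponent hf.1 α).continuousOn.aestronglyMeasurable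
    hR.isOpen.measurableSet, ?_⟩
  have hfin := (eLpNorm_lt_top_iff_lintegral_rpow_enorm_lt_top hp0 hp).1 hf.2.2
  rw [eLpNorm_lt_top_iff_lintegral_rpow_enorm_lt_top hp0 hp]
  have hφ : ContinuousOn (fun z => ‖f z‖ₑ ^ p.toReal) R :=
    ENNReal.continuous_rpow_const.comp_continuousOn hf.1.continuousOn.enorm
  rw [hR.setLIntegral_eq_orbit hφ] at hfin
  refine (setLIntegral_mono' hR.isOpen.measurableSet fun z hz => ?_).trans_lt hfin
  have hc := hR.continuous_orbit hf.1.continuousOn hz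
  have h1 : ‖torusComponent f α z‖ₑ ≤ eLpNorm (fun θ => f (torusRotate θ z)) 1
      (torusMeasure n) := by
    rw [eLpNorm_one_eq_lintegral_enorm]
    refine (enorm_integral_le_lintegral_enorm _).trans (lintegral_mono fun θ => ?_)
    rw [enorm_mul, ← ofReal_norm (UnitAddTorus.mFourier (-α) θ), norm_mFourier_apply,
      ENNReal.ofReal_one, one_mul]
  have h2 := h1.trans (eLpNorm_le_eLpNorm_of_exponent_le hp1
    (integrable_of_continuous_torus hc).aestronglyMeasurable)
  rw [eLpNorm_eq_lintegral_rpow_enorm_toReal hp0 hp, one_div,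
    ENNReal.le_rpow_inv_iff hq] at h2
  exact h2

/-- The Laurent coefficients of a function in `A^p` vanish off the allowable multi-indices. -/
theorem IsBoundedReinhardtDomain.torusComponent_eq_zero_of_notMem_allowable
    (hR : IsBoundedReinhardtDomain R) {p : ℝ≥0∞} (hp1 : 1 ≤ p) (hp : p ≠ ∞)
    (hf : MemBergman R p f) {α : Fin n → ℤ} (hα : α ∉ allowable R p) {z : Fin n → ℂ}
    (hz : z ∈ R) : torusComponent f α z = 0 := by
  obtain ⟨a, ha, hane⟩ := hR.exists_torusComponent_eq hf.1 α
  rcases eq_or_ne a 0 with rfl | ha0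
  · rw [ha z hz, zero_mul]
  refine absurd ⟨fun w hw => (differentiableAt_laurentMonomial
    (hane ha0 w hw)).differentiableWithinAt, ?_⟩ hα
  have h1 := (hR.memLp_torusComponent hp1 hp hf α).const_mul a⁻¹
  refine (memLp_congr_ae ?_).1 h1
  filter_upwards [ae_restrict_mem hR.isOpen.measurableSet] with w hw
  rw [ha w hw, inv_mul_cancel_left₀ ha0]

end Laurent

/-! ### Norm convergence of square partial sums -/

theorem ENNReal.one_lt_toReal_and_toReal_lt_two {p : ℝ≥0∞} (hp1 : 1 < p) (hp2 : p < 2) :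
    1 < p.toReal ∧ p.toReal < 2 := by
  have hp : p ≠ ∞ := (hp2.trans ENNReal.ofNat_lt_top).ne
  constructor
  · have := (ENNReal.toReal_lt_toReal ENNReal.one_ne_top hp).2 hp1
    rwa [ENNReal.toReal_one] at this
  · have := (ENNReal.toReal_lt_toReal hp ENNReal.ofNat_ne_top).2 hp2
    rwa [ENNReal.toReal_ofNat] at this

section NormConvergence

variable {n : ℕ} {R : Set (Fin n → ℂ)} {f : (Fin n → ℂ) → ℂ}

theorem IsBoundedReinhardtDomain.differentiableOn_squarePartialSum
    (hR : IsBoundedReinhardtDomain R) (hf : DifferentiableOn ℂ f R) {a : (Fin n → ℤ) → ℂ}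
    (ha : ∀ α, ∀ z ∈ R, torusComponent f α z = a α * laurentMonomial α z) (N : ℕ) :
    DifferentiableOn ℂ (squarePartialSum N a) R := by
  have : DifferentiableOn ℂ (fun z => ∑ α ∈ squareBox n N, torusComponent f α z) R :=
    DifferentiableOn.fun_sum fun α _ => hR.differentiableOn_torusComponent hf α
  exact this.congr fun z hz => Finset.sum_congr rfl fun α _ => (ha α z hz).symm

/-- The square partial sums of the Laurent expansion of `f ∈ A^p`, `1 < p < 2`, converge to `f` in
`L^p`. -/
theorem IsBoundedReinhardtDomain.tendsto_eLpNorm_squarePartialSum_sub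
    (hR : IsBoundedReinhardtDomain R) {p : ℝ≥0∞} (hp1 : 1 < p) (hp2 : p < 2)
    (hf : MemBergman R p f) {a : (Fin n → ℤ) → ℂ}
    (ha : ∀ α, ∀ z ∈ R, torusComponent f α z = a α * laurentMonomial α z) :
    Tendsto (fun N => eLpNorm (fun z => squarePartialSum N a z - f z) p (volume.restrict R))
      atTop (𝓝 0) := by
  have hp0 : p ≠ 0 := (zero_lt_one.trans hp1).ne'
  have hp : p ≠ ∞ := (hp2.trans ENNReal.ofNat_lt_top).ne
  obtain ⟨hq1, hq2⟩ := ENNReal.one_lt_toReal_and_toReal_lt_two hp1 hp2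
  set q := p.toReal with hq
  have hq0 : 0 < q := by linarith
  obtain ⟨C, hC⟩ := exists_lintegral_torus_square_le hq1 hq2 n
  have hfc := hf.1.continuousOn
  have hSc : ∀ N, ContinuousOn (fun z => squarePartialSum N a z - f z) R := fun N =>
    (hR.differentiableOn_squarePartialSum hf.1 ha N).continuousOn.sub hfc
  have hφ : ∀ {g : (Fin n → ℂ) → ℂ}, ContinuousOn g R → ContinuousOn (fun z => ‖g z‖ₑ ^ q) R :=
    fun hg => ENNReal.continuous_rpow_const.comp_continuousOn hg.enorm
  have horb : ∀ N, ∀ z ∈ R, ∀ θ, squarePartialSum N a (torusRotate θ z) =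
      ∑ α ∈ squareBox n N, torusComponent f α z * UnitAddTorus.mFourier α θ := fun N z hz θ =>
    Finset.sum_congr rfl fun α _ => by
      rw [laurentMonomial_torusRotate, ha α z hz]; ring
  simp only [eLpNorm_eq_lintegral_rpow_enorm_toReal hp0 hp, ← hq]
  have hlim : Tendsto (fun N => ∫⁻ z in R, ‖squarePartialSum N a z - f z‖ₑ ^ q) atTop (𝓝 0) := by
    simp only [hR.setLIntegral_eq_orbit (hφ (hSc _))]
    have h0 : ∫⁻ _ in R, (0 : ℝ≥0∞) = 0 := lintegral_zero
    rw [← h0]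
    -- Orbit by orbit the error tends to zero, and by the Riesz bound it is at most a fixed multiple
    -- of the orbit integral of `|f| ^ q`, which is integrable over `R`.
    refine tendsto_lintegral_of_dominated_convergence'
      (fun z => 2 ^ (q - 1) * (C + 1) * ∫⁻ θ, ‖f (torusRotate θ z)‖ₑ ^ q ∂torusMeasure n)
      (fun N => ?_) (fun N => ?_) ?_ ?_
    · exact (hR.aemeasurable_torusRotate (hφ (hSc N))).lintegral_prod_right'
    · filter_upwards [ae_restrict_mem hR.isOpen.measurableSet] with z hz
      simp only [horb N z hz]
      exact lintegral_squareBox_sub_le hq1.le hC (hR.summable_norm_torusComponent hf.1 hz)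
        (hR.continuous_orbit hfc hz) (hR.hasSum_torusComponent hf.1 hz) N
    · have hc : (2 : ℝ≥0∞) ^ (q - 1) * (C + 1) ≠ ∞ :=
        ENNReal.mul_ne_top (ENNReal.rpow_ne_top_of_nonneg (by linarith) ENNReal.ofNat_ne_top)
          (ENNReal.add_ne_top.2 ⟨ENNReal.coe_ne_top, ENNReal.one_ne_top⟩)
      rw [lintegral_const_mul' _ _ hc, ← hR.setLIntegral_eq_orbit (hφ hfc)]
      exact ENNReal.mul_ne_top hc
        ((eLpNorm_lt_top_iff_lintegral_rpow_enorm_lt_top hp0 hp).1 hf.2.2).ne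
    · filter_upwards [ae_restrict_mem hR.isOpen.measurableSet] with z hz
      simp only [horb _ z hz]
      exact tendsto_lintegral_squareBox_sub hq0 (hR.summable_norm_torusComponent hf.1 hz)
        (hR.continuous_orbit hfc hz) (hR.hasSum_torusComponent hf.1 hz)
  have := (ENNReal.continuous_rpow_const (y := 1 / q)).tendsto 0 |>.comp hlim
  rw [ENNReal.zero_rpow_of_pos (by positivity)] at this
  exact this

end NormConvergence

/-! ### The Bergman kernel -/

/-- The mean value inequality for the modulus of a holomorphic function on a polydisc. -/
theorem enorm_mul_volume_closedBall_le_lintegral {n : ℕ} {Ω : Set (Fin n → ℂ)}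
    {f : (Fin n → ℂ) → ℂ} (hf : DifferentiableOn ℂ f Ω) {z : Fin n → ℂ} {r : ℝ}
    (hz : Metric.closedBall z r ⊆ Ω) :
    ‖f z‖ₑ * volume (Metric.closedBall (0 : Fin n → ℂ) r) ≤ ∫⁻ w in Ω, ‖f w‖ₑ := by
  set B := Metric.closedBall (0 : Fin n → ℂ) r with hB
  have hmem : ∀ w ∈ B, ∀ c : ℂ, ‖c‖ ≤ 1 → z + c • w ∈ Ω := by
    intro w hw c hc
    apply hz
    rw [hB, mem_closedBall_zero_iff] at hw
    rw [mem_closedBall_iff_norm, add_sub_cancel_left, norm_smul]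
    calc ‖c‖ * ‖w‖ ≤ 1 * ‖w‖ := by gcongr
      _ ≤ r := by rwa [one_mul]
  have hpt : ∀ w ∈ B, ‖f z‖ₑ * ENNReal.ofReal (2 * Real.pi) ≤
      ∫⁻ θ in Set.Ioc 0 (2 * Real.pi), ‖f (z + circleMap 0 1 θ • w)‖ₑ := by
    intro w hw
    have hd : DifferentiableOn ℂ (fun c : ℂ => f (z + c • w)) (Metric.closedBall 0 1) :=
      hf.comp (by fun_prop) fun c hc => hmem w hw c (by simpa using hc)
    simpa using bergman_circle_bound (hd.diffContOnCl_ball subset_rfl)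
  have hcont : ContinuousOn (fun q : (Fin n → ℂ) × ℝ => ‖f (z + circleMap 0 1 q.2 • q.1)‖ₑ)
      (B ×ˢ Set.Ioc 0 (2 * Real.pi)) := by
    refine (hf.continuousOn.comp ?_ ?_).enorm
    · have : Continuous (fun q : (Fin n → ℂ) × ℝ => circleMap 0 1 q.2) :=
        (continuous_circleMap 0 1).comp continuous_snd
      fun_prop
    · rintro ⟨w, θ⟩ ⟨hw, -⟩
      exact hmem w hw _ (by simp)
  have hrot : ∀ θ : ℝ, ∫⁻ w in B, ‖f (z + circleMap 0 1 θ • w)‖ₑ ≤ ∫⁻ w in Ω, ‖f w‖ₑ := by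
    intro θ
    have hc : ‖circleMap 0 1 θ‖ = 1 := by simp
    have hmp : MeasurePreserving (fun w : Fin n → ℂ => z + circleMap 0 1 θ • w) volume volume :=
      (measurePreserving_add_left volume z).comp (bergman_rotate _ hc)
    have hemb : MeasurableEmbedding (fun w : Fin n → ℂ => z + circleMap 0 1 θ • w) := by
      have hne : circleMap 0 1 θ ≠ 0 := by intro h; simp [h] at hc
      exact ((Homeomorph.smulOfNeZero _ hne).trans
        (Homeomorph.addLeft z)).measurableEmbedding
    calc ∫⁻ w in B, ‖f (z + circleMap 0 1 θ • w)‖ₑ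
        ≤ ∫⁻ w in (fun w : Fin n → ℂ => z + circleMap 0 1 θ • w) ⁻¹' Ω,
            ‖f (z + circleMap 0 1 θ • w)‖ₑ :=
          lintegral_mono_set fun w hw => hmem w hw _ hc.le
      _ = _ := hmp.setLIntegral_comp_preimage_emb hemb (fun w => ‖f w‖ₑ) Ω
  have hI : ‖f z‖ₑ * ENNReal.ofReal (2 * Real.pi) * volume B ≤
      (∫⁻ w in Ω, ‖f w‖ₑ) * ENNReal.ofReal (2 * Real.pi) := by
    calc ‖f z‖ₑ * ENNReal.ofReal (2 * Real.pi) * volume B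
        = ∫⁻ _ in B, ‖f z‖ₑ * ENNReal.ofReal (2 * Real.pi) := by simp
      _ ≤ ∫⁻ w in B, ∫⁻ θ in Set.Ioc 0 (2 * Real.pi), ‖f (z + circleMap 0 1 θ • w)‖ₑ :=
          setLIntegral_mono' Metric.isClosed_closedBall.measurableSet hpt
      _ = ∫⁻ θ in Set.Ioc 0 (2 * Real.pi), ∫⁻ w in B, ‖f (z + circleMap 0 1 θ • w)‖ₑ := by
          refine lintegral_lintegral_swap ?_
          rw [Measure.prod_restrict]
          exact hcont.aemeasurable
            (Metric.isClosed_closedBall.measurableSet.prod measurableSet_Ioc)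
      _ ≤ ∫⁻ _ in Set.Ioc 0 (2 * Real.pi), ∫⁻ w in Ω, ‖f w‖ₑ := lintegral_mono fun θ => hrot θ
      _ = _ := by simp
  rw [mul_right_comm] at hI
  exact (ENNReal.mul_le_mul_iff_left (by simpa using Real.pi_pos) ENNReal.ofReal_ne_top).1 hI

section Kernel

variable {n : ℕ} {Ω : Set (Fin n → ℂ)}

/-- The functions `conj B(z, ·)` and `conj B(w, ·)` both lie in `A²`, and each is reproduced by the
kernel at the other point. The symmetry transfers holomorphy to the first variable. -/
theorem bergmanKernel_conj_symm (hΩ : IsOpen Ω) {z w : Fin n → ℂ} (hz : z ∈ Ω) (hw : w ∈ Ω) :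
    (starRingEnd ℂ) (bergmanKernel hΩ w z) = bergmanKernel hΩ z w := by
  have h := bergmanKernel_spec hΩ
  have e1 := congrArg (starRingEnd ℂ) ((h w hw).2 _ (h z hz).1)
  rw [Complex.conj_conj, ← integral_conj] at e1
  rw [e1, (h z hz).2 _ (h w hw).1]
  refine integral_congr_ae (ae_of_all _ fun v => ?_)
  simp [mul_comm]

theorem differentiableOn_bergmanKernel_left (hΩ : IsOpen Ω) {w : Fin n → ℂ} (hw : w ∈ Ω) :
    DifferentiableOn ℂ (fun z => bergmanKernel hΩ z w) Ω :=
  ((bergmanKernel_spec hΩ w hw).1.1).congr fun _ hz => (bergmanKernel_conj_symm hΩ hz hw).symm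

theorem continuousOn_bergmanKernel_right (hΩ : IsOpen Ω) {z : Fin n → ℂ} (hz : z ∈ Ω) :
    ContinuousOn (fun w => bergmanKernel hΩ z w) Ω := by
  have := Complex.continuous_conj.comp_continuousOn (bergmanKernel_spec hΩ z hz).1.1.continuousOn
  simpa [Function.comp_def] using this

/-- A function continuous in one variable and measurable in the other is jointly measurable. Values
of the kernel off `Ω × Ω` are unspecified, so the argument runs on the subtype and the result is
then extended. -/
theorem aestronglyMeasurable_bergmanKernel (hΩ : IsOpen Ω) :
    AEStronglyMeasurable (fun p : (Fin n → ℂ) × (Fin n → ℂ) => bergmanKernel hΩ p.1 p.2)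
      ((volume.restrict Ω).prod (volume.restrict Ω)) := by
  set u : Ω → Ω → ℂ := fun z w => bergmanKernel hΩ z w with hu
  have hmeas : Measurable (Function.uncurry u) := by
    refine measurable_uncurry_of_continuous_of_measurable (fun w => ?_) fun z => ?_
    · exact (differentiableOn_bergmanKernel_left hΩ w.2).continuousOn.domRestrict
    · exact (continuousOn_bergmanKernel_right hΩ z.2).domRestrict.measurable
  have he : MeasurableEmbedding (Prod.map (Subtype.val : Ω → Fin n → ℂ)
      (Subtype.val : Ω → Fin n → ℂ)) :=
    (MeasurableEmbedding.subtype_coe hΩ.measurableSet).prodMap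
      (MeasurableEmbedding.subtype_coe hΩ.measurableSet)
  obtain ⟨G, hG, hGu⟩ := he.exists_measurable_extend hmeas fun _ => inferInstance
  refine (hG.aestronglyMeasurable).congr ?_
  rw [Measure.prod_restrict]
  filter_upwards [ae_restrict_mem (hΩ.measurableSet.prod hΩ.measurableSet)] with p hp
  exact congrFun hGu (⟨p.1, hp.1⟩, ⟨p.2, hp.2⟩)

variable {p : ℝ≥0∞} {f : (Fin n → ℂ) → ℂ}

/-- `|𝐁||f|` as a lower Lebesgue integral. -/
theorem enorm_absBergman_norm_eq (hΩ : IsOpen Ω) {z : Fin n → ℂ}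
    (h : IntegrableOn (fun w => (‖bergmanKernel hΩ z w‖ : ℂ) * (‖f w‖ : ℂ)) Ω) :
    ‖absBergman hΩ (fun w => (‖f w‖ : ℂ)) z‖ₑ = ∫⁻ w in Ω, ‖bergmanKernel hΩ z w * f w‖ₑ := by
  have h1 : IntegrableOn (fun w => ‖bergmanKernel hΩ z w * f w‖) Ω :=
    h.norm.congr (ae_of_all _ fun w => by simp)
  rw [absBergman]
  have h2 : ∀ w, (‖bergmanKernel hΩ z w‖ : ℂ) * (‖f w‖ : ℂ) =
      ((‖bergmanKernel hΩ z w * f w‖ : ℝ) : ℂ) := fun w => by simp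
  simp only [h2]
  have h3 : ∫ w in Ω, ((‖bergmanKernel hΩ z w * f w‖ : ℝ) : ℂ) =
      ((∫ w in Ω, ‖bergmanKernel hΩ z w * f w‖ : ℝ) : ℂ) := integral_ofReal
  rw [h3, ← ofReal_norm, Complex.norm_real, Real.norm_of_nonneg
    (integral_nonneg fun w => norm_nonneg _), ofReal_integral_eq_lintegral_ofReal h1
    (ae_of_all _ fun w => norm_nonneg _)]
  simp only [ofReal_norm]

theorem memLp_ofReal_norm (hf : MemLp f p (volume.restrict Ω)) :
    MemLp (fun w => (‖f w‖ : ℂ)) p (volume.restrict Ω) := hf.norm.ofReal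

theorem aestronglyMeasurable_bergmanKernel_mul (hΩ : IsOpen Ω)
    (hf : AEStronglyMeasurable f (volume.restrict Ω)) :
    AEStronglyMeasurable (fun p : (Fin n → ℂ) × (Fin n → ℂ) => bergmanKernel hΩ p.1 p.2 * f p.2)
      ((volume.restrict Ω).prod (volume.restrict Ω)) :=
  (aestronglyMeasurable_bergmanKernel hΩ).mul hf.comp_snd

/-- The hypothesis applied to `|f|` puts `|𝐁||f|` in `L^p`, hence in `L^1` because the volume is
finite. -/
theorem AbsBergmanBounded.lintegral_lintegral_lt_top {hΩ : IsOpen Ω}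
    (hB : AbsBergmanBounded hΩ p) (hp : 1 ≤ p) (hΩb : volume Ω ≠ ∞)
    (hf : MemLp f p (volume.restrict Ω)) :
    ∫⁻ z in Ω, ∫⁻ w in Ω, ‖bergmanKernel hΩ z w * f w‖ₑ < ∞ := by
  obtain ⟨C, hC⟩ := hB
  have hfn := memLp_ofReal_norm hf
  obtain ⟨h1, h2⟩ := hC _ hfn
  have : IsFiniteMeasure (volume.restrict Ω) := ⟨by simpa using hΩb.lt_top⟩
  have hmem : MemLp (absBergman hΩ fun w => (‖f w‖ : ℂ)) p (volume.restrict Ω) := by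
    refine ⟨?_, h2.trans_lt (ENNReal.mul_lt_top ENNReal.coe_lt_top hfn.2)⟩
    have hm : AEStronglyMeasurable (fun p : (Fin n → ℂ) × (Fin n → ℂ) =>
        (‖bergmanKernel hΩ p.1 p.2‖ : ℂ) * (‖f p.2‖ : ℂ))
        ((volume.restrict Ω).prod (volume.restrict Ω)) :=
      (Complex.continuous_ofReal.comp_aestronglyMeasurable
        (aestronglyMeasurable_bergmanKernel hΩ).norm).mul hfn.1.comp_snd
    exact hm.integral_prod_right'
  have hmem1 := hmem.mono_exponent hp
  have hlt := hmem1.2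
  rw [eLpNorm_one_eq_lintegral_enorm] at hlt
  refine lt_of_eq_of_lt (lintegral_congr_ae ?_) hlt
  filter_upwards [h1] with z hz
  exact (enorm_absBergman_norm_eq hΩ hz).symm

/-- If `|𝐁|` is bounded on `L^p`, the integral defining `𝐁f` converges at every point. -/
theorem AbsBergmanBounded.bergmanConverges {hΩ : IsOpen Ω}
    (hB : AbsBergmanBounded hΩ p) (hp : 1 ≤ p) (hΩb : volume Ω ≠ ∞)
    (hf : MemLp f p (volume.restrict Ω)) {z : Fin n → ℂ} (hz : z ∈ Ω) :
    BergmanConverges hΩ f z := by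
  refine ⟨((continuousOn_bergmanKernel_right hΩ hz).aestronglyMeasurable hΩ.measurableSet).mul
    hf.1, ?_⟩
  obtain ⟨r, hr, hsub⟩ := Metric.nhds_basis_closedBall.mem_iff.1 (hΩ.mem_nhds hz)
  set V := volume (Metric.closedBall (0 : Fin n → ℂ) r) with hV
  have hV0 : V ≠ 0 := (Metric.measure_closedBall_pos _ _ hr).ne'
  have hVt : V ≠ ⊤ := (isCompact_closedBall _ _).measure_lt_top.ne
  -- For each fixed `w`, the mean value inequality in the first variable bounds `|B(z, w) f(w)| V`
  -- by the integral of `|B(·, w) f(w)|` over `Ω`. By Tonelli the total is at most the finite double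
  -- integral.
  have hmain : (∫⁻ w in Ω, ‖bergmanKernel hΩ z w * f w‖ₑ) * V < ∞ := by
    refine lt_of_le_of_lt ?_ (hB.lintegral_lintegral_lt_top hp hΩb hf)
    rw [← lintegral_mul_const' _ _ hVt, lintegral_lintegral_swap
      (aestronglyMeasurable_bergmanKernel_mul hΩ hf.1).enorm]
    refine setLIntegral_mono' hΩ.measurableSet fun w hw => ?_
    exact enorm_mul_volume_closedBall_le_lintegral
      ((differentiableOn_bergmanKernel_left hΩ hw).mul_const (f w)) hsub
  by_contra hcon
  rw [HasFiniteIntegral, not_lt, top_le_iff] at hcon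
  rw [hcon, ENNReal.top_mul hV0] at hmain
  exact lt_irrefl _ hmain

/-- Almost everywhere `|𝐁f| ≤ |𝐁||f|`, so the hypothesis is applied to `|f|`. -/
theorem AbsBergmanBounded.exists_eLpNorm_bergmanProj_le {hΩ : IsOpen Ω}
    (hB : AbsBergmanBounded hΩ p) : ∃ C : ℝ≥0, ∀ f, MemLp f p (volume.restrict Ω) →
      eLpNorm (bergmanProj hΩ f) p (volume.restrict Ω) ≤ C * eLpNorm f p (volume.restrict Ω) := by
  obtain ⟨C, hC⟩ := hB
  refine ⟨C, fun f hf => ?_⟩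
  obtain ⟨h1, h2⟩ := hC _ (memLp_ofReal_norm hf)
  have h3 : eLpNorm (fun w => (‖f w‖ : ℂ)) p (volume.restrict Ω) =
      eLpNorm f p (volume.restrict Ω) := by
    refine eLpNorm_congr_norm_ae (ae_of_all _ fun w => ?_)
    simp
  rw [h3] at h2
  refine le_trans (eLpNorm_mono_enorm_ae ?_) h2
  filter_upwards [h1] with z hz
  rw [enorm_absBergman_norm_eq hΩ hz]
  exact enorm_integral_le_lintegral_enorm _

theorem AbsBergmanBounded.memLp_bergmanProj {hΩ : IsOpen Ω} (hB : AbsBergmanBounded hΩ p)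
    (hf : MemLp f p (volume.restrict Ω)) : MemLp (bergmanProj hΩ f) p (volume.restrict Ω) := by
  obtain ⟨C, hC⟩ := hB.exists_eLpNorm_bergmanProj_le
  exact ⟨(aestronglyMeasurable_bergmanKernel_mul hΩ hf.1).integral_prod_right',
    (hC f hf).trans_lt (ENNReal.mul_lt_top ENNReal.coe_lt_top hf.2)⟩

end Kernel

/-! ### The Bergman projection on Reinhardt domains -/

section Reinhardt

variable {n : ℕ} {R : Set (Fin n → ℂ)}

theorem IsBoundedReinhardtDomain.volume_ne_top (hR : IsBoundedReinhardtDomain R) :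
    volume R ≠ ∞ := hR.isBounded.measure_lt_top.ne

/-- Monomials that are holomorphic but not square integrable are annihilated by the Bergman
projection, as soon as the defining integral converges. -/
theorem IsBoundedReinhardtDomain.bergmanProj_laurentMonomial_eq_zero
    (hR : IsBoundedReinhardtDomain R) {γ : Fin n → ℤ}
    (hd : DifferentiableOn ℂ (laurentMonomial γ) R) (hγ : γ ∉ allowable R 2) {z : Fin n → ℂ}
    (hz : z ∈ R) (hc : BergmanConverges hR.isOpen (laurentMonomial γ) z) :
    bergmanProj hR.isOpen (laurentMonomial γ) z = 0 := by
  have hcont : ContinuousOn (fun w => bergmanKernel hR.isOpen z w * laurentMonomial γ w) R :=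
    (continuousOn_bergmanKernel_right hR.isOpen hz).mul hd.continuousOn
  rw [bergmanProj, hR.setIntegral_eq_orbit hcont hc]
  -- The orbit integral through `w` is `e_γ(w)` times the conjugate of the weight-`γ` component of
  -- `conj B(z, ·)`. That function is in `A²` and `γ` is not `L²`-allowable, so the component is
  -- zero.
  refine setIntegral_eq_zero_of_forall_eq_zero fun w hw => ?_
  have h0 := hR.torusComponent_eq_zero_of_notMem_allowable one_le_two ENNReal.ofNat_ne_top
    (bergmanKernel_spec hR.isOpen z hz).1 hγ hw
  have h1 := congrArg (starRingEnd ℂ) h0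
  rw [torusComponent, ← integral_conj, map_zero] at h1
  calc ∫ θ, bergmanKernel hR.isOpen z (torusRotate θ w) * laurentMonomial γ (torusRotate θ w)
        ∂torusMeasure n
      = ∫ θ, laurentMonomial γ w * (starRingEnd ℂ) (UnitAddTorus.mFourier (-γ) θ *
          (starRingEnd ℂ) (bergmanKernel hR.isOpen z (torusRotate θ w))) ∂torusMeasure n := by
        refine integral_congr_ae (ae_of_all _ fun θ => ?_)
        dsimp only
        rw [laurentMonomial_torusRotate, map_mul, Complex.conj_conj, UnitAddTorus.mFourier_neg,
          Complex.conj_conj]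
        ring
    _ = 0 := by rw [integral_const_mul, h1, mul_zero]

/-- Three cases: `L²`-allowable exponents are reproduced, exponents allowable only for `L^p` are
annihilated, and for the remaining ones the coefficient is zero, so that no integrability of `e_α`
is needed. -/
theorem IsBoundedReinhardtDomain.bergmanProj_laurentMonomial (hR : IsBoundedReinhardtDomain R)
    {p : ℝ≥0∞} (hp : 1 ≤ p) (hB : AbsBergmanBounded hR.isOpen p) {α : Fin n → ℤ} {a : ℂ}
    (ha : α ∉ allowable R p → a = 0) {z : Fin n → ℂ} (hz : z ∈ R) :
    IntegrableOn (fun w => bergmanKernel hR.isOpen z w * (a * laurentMonomial α w)) R ∧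
      ∫ w in R, bergmanKernel hR.isOpen z w * (a * laurentMonomial α w) =
        (allowable R 2).indicator (fun _ => a) α * laurentMonomial α z := by
  by_cases hα : α ∈ allowable R p
  · have hc := hB.bergmanConverges hp hR.volume_ne_top hα.2 hz
    simp only [mul_left_comm _ a]
    refine ⟨hc.const_mul a, ?_⟩
    rw [integral_const_mul]
    by_cases h2 : α ∈ allowable R 2
    · rw [Set.indicator_of_mem h2, ← (bergmanKernel_spec hR.isOpen z hz).2 _ h2]
    · have := hR.bergmanProj_laurentMonomial_eq_zero hα.1 h2 hz hc
      rw [bergmanProj] at this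
      rw [Set.indicator_of_notMem h2, this, mul_zero, zero_mul]
  · obtain rfl := ha hα
    simp

theorem IsBoundedReinhardtDomain.bergmanProj_squarePartialSum_sub
    (hR : IsBoundedReinhardtDomain R) {p : ℝ≥0∞} (hp : 1 ≤ p)
    (hB : AbsBergmanBounded hR.isOpen p) {f : (Fin n → ℂ) → ℂ}
    (hf : MemLp f p (volume.restrict R)) {a : (Fin n → ℤ) → ℂ}
    (ha : ∀ α ∉ allowable R p, a α = 0) (N : ℕ) {z : Fin n → ℂ} (hz : z ∈ R) :
    bergmanProj hR.isOpen (fun w => squarePartialSum N a w - f w) z =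
      squarePartialSum N ((allowable R 2).indicator a) z - bergmanProj hR.isOpen f z := by
  have hmono := fun α => hR.bergmanProj_laurentMonomial hp hB (ha α) hz
  have hc := hB.bergmanConverges hp hR.volume_ne_top hf hz
  simp only [bergmanProj, mul_sub, squarePartialSum, Finset.mul_sum]
  rw [integral_sub (integrable_finsetSum _ fun α _ => (hmono α).1) hc,
    integral_finsetSum _ fun α _ => (hmono α).1]
  congr 1
  exact Finset.sum_congr rfl fun α _ => by rw [(hmono α).2, Set.indicator, Set.indicator]

end Reinhardt

theorem propositionP {n : ℕ} {R : Set (Fin n → ℂ)} (hR : IsBoundedReinhardtDomain R)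
    {p : ℝ≥0∞} (hp1 : 1 < p) (hp2 : p < 2) (hB : AbsBergmanBounded hR.isOpen p) :
    (∀ γ ∈ allowable R p \ allowable R 2, ∀ z ∈ R,
      BergmanConverges hR.isOpen (laurentMonomial γ) z ∧
        bergmanProj hR.isOpen (laurentMonomial γ) z = 0) ∧
    ∀ f : (Fin n → ℂ) → ℂ, MemBergman R p f →
      (∃! a : (Fin n → ℤ) → ℂ, IsLaurentExpansion R f a) ∧
      (∀ z ∈ R, BergmanConverges hR.isOpen f z) ∧
      MemLp (bergmanProj hR.isOpen f) p (volume.restrict R) ∧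
      ∀ a : (Fin n → ℤ) → ℂ, IsLaurentExpansion R f a →
        (∀ α ∉ allowable R p, a α = 0) ∧
        Tendsto (fun N : ℕ => eLpNorm
            (fun z => squarePartialSum N ((allowable R 2).indicator a) z
              - bergmanProj hR.isOpen f z) p (volume.restrict R))
          atTop (𝓝 0) := by
  have hconv : ∀ {f : (Fin n → ℂ) → ℂ}, MemLp f p (volume.restrict R) → ∀ z ∈ R,
      BergmanConverges hR.isOpen f z := fun hf z hz =>
    hB.bergmanConverges hp1.le hR.volume_ne_top hf hz
  refine ⟨fun γ hγ z hz => ⟨hconv hγ.1.2 z hz, hR.bergmanProj_laurentMonomial_eq_zero hγ.1.1 hγ.2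
    hz (hconv hγ.1.2 z hz)⟩, fun f hf => ⟨hR.existsUnique_isLaurentExpansion hf.1, hconv hf.2,
    hB.memLp_bergmanProj hf.2, fun a ha => ?_⟩⟩
  have hcomp : ∀ α, ∀ z ∈ R, torusComponent f α z = a α * laurentMonomial α z := fun α z hz =>
    hR.torusComponent_eq_of_isLaurentExpansion hf.1 ha α hz
  have hzero : ∀ α ∉ allowable R p, a α = 0 := by
    intro α hα
    obtain ⟨z₁, hz₁⟩ := hR.isConnected.nonempty
    obtain ⟨z, hz, -, hne⟩ := hR.isOpen.exists_coord_ne_zero hz₁ ∅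
    have h := hR.torusComponent_eq_zero_of_notMem_allowable hp1.le
      (hp2.trans ENNReal.ofNat_lt_top).ne hf hα hz
    rw [hcomp α z hz] at h
    exact (mul_eq_zero.1 h).resolve_right
      (laurentMonomial_ne_zero fun j => hne j (Set.notMem_empty j))
  refine ⟨hzero, ?_⟩
  -- On `R`, applying `𝐁` to `S_N f - f` gives exactly the difference to be estimated, so its norm
  -- is at most `C` times that of `S_N f - f`, which tends to zero.
  obtain ⟨C, hC⟩ := hB.exists_eLpNorm_bergmanProj_le
  have hS : ∀ N, MemLp (fun z => squarePartialSum N a z - f z) p (volume.restrict R) := by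
    intro N
    refine MemLp.sub (memLp_finsetSum _ fun α _ => ?_) hf.2
    by_cases hα : α ∈ allowable R p
    · exact hα.2.const_mul _
    · simp [hzero α hα]
  have hlim := ENNReal.Tendsto.const_mul (a := (C : ℝ≥0∞))
    (hR.tendsto_eLpNorm_squarePartialSum_sub hp1 hp2 hf hcomp) (Or.inr ENNReal.coe_ne_top)
  rw [mul_zero] at hlim
  refine tendsto_of_tendsto_of_tendsto_of_le_of_le tendsto_const_nhds hlim
    (fun _ => zero_le) fun N => ?_
  refine le_trans (le_of_eq (eLpNorm_congr_ae ?_)) (hC _ (hS N))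
  filter_upwards [ae_restrict_mem hR.isOpen.measurableSet] with z hz
  exact (hR.bergmanProj_squarePartialSum_sub hp1.le hB hf.2 hzero N hz).symm
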